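/- Let $X$ be an infinite-dimensional complex Banach space. For an operator $A$ in $X$ with domain $\mathcal D(A)$ let $\mathcal D(A^n)=\{x: x,Ax,\dots,A^{n-1}x\in\mathcal D(A)\}$, let $\rho(A)$ be the set of $\lambda\in\mathbb C$ for which $\lambda-A:\mathcal D(A)\to X$ is bijective, $\sigma(A)=\mathbb C\setminus\rho(A)$ and $\sigma_\infty(A)=\sigma(A)\cup\{\infty\}\subset\mathbb C\cup\{\infty\}$. $A$ is Fredholm if its range is closed and of finite codimension and its null space is finite-dimensional, and Browder if moreover its ascent and descent are finite; $\sigma_e(A)$ (resp. $\sigma_b(A)$) is the set of $\lambda$ for which $A-\lambda$ is not Fredholm (resp. not Browder), and the points of $\sigma(A)\setminus\sigma_b(A)$ are the Riesz points of $A$. A bounded operator $T$ on $X$ is Riesz if $\sigma_e(T)=\{0\}$. A bounded set $\sigma\subset\sigma(A)$ is a bounded spectral set of $A$ if it is open and closed in $\sigma_\infty(A)$; its spectral projection $P_\sigma$ is the bounded projection with null space $M$ and range $N\subset\mathcal D(A)$, both invariant under $A$, such that the parts of $A$ in $M$ and $N$ satisfy $\sigma(A_M)=\sigma(A)\setminus\sigma$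 and $\sigma(A_N)=\sigma$. The Drazin inverse of $A$ related to $\sigma\ni 0$ is $A^{D,\sigma}=(A-\xi P_\sigma)^{-1}(I-P_\sigma)$ for some $\xi\in\mathbb C$ with $|\xi|>2\sup_{\lambda\in\sigma}|\lambda|$. A bounded operator $B$ is a generalized Drazin–Riesz inverse of $A$ if the ranges of $B$ and $I-AB$ lie in $\mathcal D(A)$, $BAB=B$, $BAx=ABx$ for $x\in\mathcal D(A)$, and $A(I-AB)$ is bounded and Riesz. Let $A$ be a closed densely defined operator in $X$ with $\sigma_e(A)\ne\mathbb C$ and $\mathcal D(A^{j+1})=\mathcal D(A^j)$ for all sufficiently large $j$, and suppose that $0$ is an isolated point of $\sigma_b(A)$. Call a bounded spectral set $\sigma$ of $A$ suitable if $0\in\sigma$, every point of $\sigma\setminus\{0\}$ is a Riesz point of $A$, and for some $r_0<\frac14$ one has $\sigma\subset D(0,r_0)$ and $(D(0,r_0)\setminus\{0\})\cap(\sigma(A)\setminus\sigma)=\emptyset$, where $D(0,r_0)=\{z\in\mathbb C:|z|<r_0\}$. Then suitable sets exist. For every suitable $\sigma$, the operators $P_\sigma$ and $A^{D,\sigma}$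 exist, $A^{D,\sigma}$ is a generalized Drazin–Riesz inverse of $A$, the operators $AP_\sigma$, $AA^{D,\sigma}$ and $A^{p}(I-AA^{D,\sigma})$, $p\ge 0$, are everywhere defined and bounded, and for every $\lambda\in\mathbb C$ with $r(AP_\sigma)<|\lambda|<r(A^{D,\sigma})^{-1}$, where $r$ is the spectral radius and $0^{-1}=\infty$, one has $\lambda\in\rho(A)$ and $$(\lambda-A)^{-1}=\sum_{p=1}^{\infty}\lambda^{-p}A^{p-1}(I-AA^{D,\sigma})-\sum_{p=0}^{\infty}\lambda^{p}(A^{D,\sigma})^{p+1},$$ both series converging unconditionally in the operator norm. -/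

import Mathlib

open Topology Filter

noncomputable section

namespace ClosedOp

section Algebraic

variable {E : Type*} [AddCommGroup E] [Module ℂ E]

/-- A linear map regarded as an everywhere defined operator. -/
def ofLinear (T : E →ₗ[ℂ] E) : E →ₗ.[ℂ] E := T.toPMap ⊤

/-- The product `g f`, with its natural domain `{x ∈ D(f) : f x ∈ D(g)}`. -/
def pcomp (g f : E →ₗ.[ℂ] E) : E →ₗ.[ℂ] E :=
  g.comp (f.domRestrict ((g.domain.comap f.toFun).map f.domain.subtype)) (by
    rintro ⟨x, hx, hxf⟩
    obtain ⟨y, hy, rfl⟩ := hx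
    exact hy)

/-- The powers of an operator; `D(Aⁿ) = {x : x, A x, …, Aⁿ⁻¹ x ∈ D(A)}` and `A⁰ = I`. -/
def pow (A : E →ₗ.[ℂ] E) : ℕ → (E →ₗ.[ℂ] E)
  | 0 => ofLinear LinearMap.id
  | n + 1 => pcomp A (pow A n)

/-- The operator `z - A`, with domain `D(A)`. -/
def scalarSub (z : ℂ) (A : E →ₗ.[ℂ] E) : E →ₗ.[ℂ] E :=
  (z • (LinearMap.id : E →ₗ[ℂ] E)) +ᵥ (-A)

/-- The operator `A - T`, with domain `D(A)`, for an everywhere defined `T`. -/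
def subLinear (A : E →ₗ.[ℂ] E) (T : E →ₗ[ℂ] E) : E →ₗ.[ℂ] E := (-T) +ᵥ A

/-- The null space, as a subspace of the whole space. -/
def nullSpace (A : E →ₗ.[ℂ] E) : Submodule ℂ E :=
  (LinearMap.ker A.toFun).map A.domain.subtype

/-- The range. -/
def rangeSpace (A : E →ₗ.[ℂ] E) : Submodule ℂ E := LinearMap.range A.toFun

/-- The resolvent set `{z : z - A is bijective from D(A) onto the space}`. -/
def resolventSet (A : E →ₗ.[ℂ] E) : Set ℂ :=
  {z | Function.Bijective (scalarSub z A)}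

/-- The spectrum. -/
def spec (A : E →ₗ.[ℂ] E) : Set ℂ := (resolventSet A)ᶜ

/-- The compactified spectrum `σ(A) ∪ {∞}` in the Riemann sphere. -/
def specInfty (A : E →ₗ.[ℂ] E) : Set (OnePoint ℂ) :=
  ((↑) : ℂ → OnePoint ℂ) '' spec A ∪ {OnePoint.infty}

/-- A spectral set: a clopen subset of the compactified spectrum. -/
def IsSpectralSet (A : E →ₗ.[ℂ] E) (s : Set (OnePoint ℂ)) : Prop :=
  s ⊆ specInfty A ∧ IsClopen (Subtype.val ⁻¹' s : Set (specInfty A))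

/-- A bounded spectral set, given as a subset of the plane. -/
def IsBoundedSpectralSet (A : E →ₗ.[ℂ] E) (s : Set ℂ) : Prop :=
  Bornology.IsBounded s ∧ IsSpectralSet A (((↑) : ℂ → OnePoint ℂ) '' s)

/-- The part `A_M` of `A` in an invariant subspace `M`, with `D(A_M) = M ∩ D(A)`. -/
def part (A : E →ₗ.[ℂ] E) (M : Submodule ℂ E)
    (h : ∀ x : A.domain, (x : E) ∈ M → A x ∈ M) : M →ₗ.[ℂ] M where
  domain := A.domain.comap M.subtype
  toFun :=
    { toFun := fun x => ⟨A ⟨((x : M) : E), x.2⟩, h _ (x : M).2⟩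
      map_add' := fun x y => Subtype.ext (A.map_add ⟨_, x.2⟩ ⟨_, y.2⟩)
      map_smul' := fun c x => Subtype.ext (A.map_smul c ⟨_, x.2⟩) }

end Algebraic

variable {X : Type*} [NormedAddCommGroup X] [NormedSpace ℂ X]

/-- Fredholm operators: closed range, finite-dimensional null space, range of finite
codimension. -/
structure IsFredholm (A : X →ₗ.[ℂ] X) : Prop where
  isClosed_range : IsClosed (rangeSpace A : Set X)
  finite_nullSpace : FiniteDimensional ℂ (nullSpace A)
  finite_codim : FiniteDimensional ℂ (X ⧸ rangeSpace A)

/-- Browder operators: Fredholm operators of finite ascent and finite descent. -/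
structure IsBrowder (A : X →ₗ.[ℂ] X) : Prop where
  isFredholm : IsFredholm A
  finite_ascent : ∃ n : ℕ, nullSpace (pow A n) = nullSpace (pow A (n + 1))
  finite_descent : ∃ n : ℕ, rangeSpace (pow A n) = rangeSpace (pow A (n + 1))

/-- The essential spectrum. -/
def essSpec (A : X →ₗ.[ℂ] X) : Set ℂ :=
  {z | ¬ IsFredholm (subLinear A (z • LinearMap.id))}

/-- The Browder spectrum. -/
def browderSpec (A : X →ₗ.[ℂ] X) : Set ℂ :=
  {z | ¬ IsBrowder (subLinear A (z • LinearMap.id))}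

/-- The Riesz points `σ(A) \ σ_b(A)`. -/
def rieszPoints (A : X →ₗ.[ℂ] X) : Set ℂ := spec A \ browderSpec A

/-- Isolated points of a set of complex numbers. -/
def isoPts (K : Set ℂ) : Set ℂ := {z | z ∈ K ∧ ¬ AccPt z (𝓟 K)}

/-- Bounded Riesz operators. -/
def IsRiesz (T : X →L[ℂ] X) : Prop := essSpec (ofLinear (T : X →ₗ[ℂ] X)) = {0}

/-- The class `Ĉ(X)`: closed densely defined operators with non-empty essential resolvent set
for which `D(Aʲ⁺¹) = D(Aʲ)` for all sufficiently large `j`. -/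
structure MemChat (A : X →ₗ.[ℂ] X) : Prop where
  isClosed : A.IsClosed
  dense_domain : Dense (A.domain : Set X)
  essResolvent_nonempty : ((essSpec A)ᶜ).Nonempty
  domain_stabilizes : ∃ J : ℕ, ∀ j ≥ J, (pow A (j + 1)).domain = (pow A j).domain

/-- `(M, N) ∈ Red(A)`. -/
structure IsReduction (A : X →ₗ.[ℂ] X) (M N : Submodule ℂ X) : Prop where
  isClosed_left : IsClosed (M : Set X)
  isClosed_right : IsClosed (N : Set X)
  map_left : ∀ x : A.domain, (x : X) ∈ M → A x ∈ M
  right_le_domain : N ≤ A.domain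
  map_right : ∀ x : A.domain, (x : X) ∈ N → A x ∈ N
  isCompl : IsCompl M N

/-- `P` is the spectral projection of `A` relative to `s`: the bounded projection whose null space
`M` and range `N` form a reduction of `A` with `σ(A_M) = σ(A) \ s` and `σ(A_N) = s`. -/
def IsSpectralProjection (A : X →ₗ.[ℂ] X) (s : Set ℂ) (P : X →L[ℂ] X) : Prop :=
  IsIdempotentElem P ∧
    ∃ h : IsReduction A (LinearMap.ker (P : X →ₗ[ℂ] X)) (LinearMap.range (P : X →ₗ[ℂ] X)),
      spec (part A _ h.map_left) = spec A \ s ∧ spec (part A _ h.map_right) = s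

/-- `R` is a bounded everywhere defined two-sided inverse of `T`. -/
def IsBoundedInverse (T : X →ₗ.[ℂ] X) (R : X →L[ℂ] X) : Prop :=
  (∀ x : X, (R x, x) ∈ T.graph) ∧ ∀ x : T.domain, R (T x) = x

/-- `B = (A - ξ P)⁻¹ (I - P)` for some `ξ` with `|ξ| > 2 sup_{z ∈ s} |z|`, where `P` is the
spectral projection of `A` relative to `s`: the Drazin inverse of `A` related to `s`. -/
def IsRelDrazinInverse (A : X →ₗ.[ℂ] X) (s : Set ℂ) (P B : X →L[ℂ] X) : Prop :=
  IsSpectralProjection A s P ∧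
    ∃ (ξ : ℂ) (C : X →L[ℂ] X), 2 * sSup (norm '' s) < ‖ξ‖ ∧
      IsBoundedInverse (subLinear A (ξ • (P : X →ₗ[ℂ] X))) C ∧ B = C ∘L (1 - P)

/-- `B` is a generalized Drazin-Riesz inverse of `A`. -/
structure IsGenDrazinRieszInverse (A : X →ₗ.[ℂ] X) (B : X →L[ℂ] X) : Prop where
  range_subset : ∀ x : X, B x ∈ A.domain
  range_compl_subset : ∀ x : X, x - A ⟨B x, range_subset x⟩ ∈ A.domain
  inner : ∀ x : X, B (A ⟨B x, range_subset x⟩) = B x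
  comm : ∀ x : A.domain, B (A x) = A ⟨B x, range_subset x⟩
  riesz : ∃ R : X →L[ℂ] X,
    (∀ x : X, R x = A ⟨x - A ⟨B x, range_subset x⟩, range_compl_subset x⟩) ∧ IsRiesz R

/-- The product `A B` is everywhere defined and bounded. -/
def IsBoundedProd (A : X →ₗ.[ℂ] X) (B : X →L[ℂ] X) : Prop :=
  ∃ C : X →L[ℂ] X, ∀ x : X, (B x, C x) ∈ A.graph

open Classical in
/-- The bounded operator `A B`, when the product is everywhere defined and bounded
(and `0` otherwise). -/
def prodL (A : X →ₗ.[ℂ] X) (B : X →L[ℂ] X) : X →L[ℂ] X :=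
  if h : IsBoundedProd A B then h.choose else 0

/-- The spectral sets `σ_{n₀}` for a suitable `n₀`: bounded spectral sets that consist of `0` and
of Riesz points of `A`, and that some disc `D(0, r₀)` with `r₀ < 1/4` separates from the rest of
the spectrum. -/
structure IsSuitable (A : X →ₗ.[ℂ] X) (s : Set ℂ) : Prop where
  isBoundedSpectralSet : IsBoundedSpectralSet A s
  zero_mem : (0 : ℂ) ∈ s
  riesz : s \ {0} ⊆ rieszPoints A
  disc : ∃ r : ℝ, r < 1 / 4 ∧ s ⊆ Metric.ball 0 r ∧
    (Metric.ball 0 r \ {0}) ∩ (spec A \ s) = ∅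

end ClosedOp

end

namespace ClosedOp

/-! ### Everywhere defined operators and their parts in invariant subspaces -/

section Algebraic

variable {E : Type*} [AddCommGroup E] [Module ℂ E]

/-! The hypotheses force `A` to be bounded and everywhere defined. Some `A - z` has range of finite
codimension, and this carries the equality `D(A^(J+1)) = D(A^J)` down to `j = 0` up to
finite-dimensional errors, so `D(A)` has finite codimension. As the range of the projection of the
closed graph to its first coordinate, `D(A)` is then closed. Being dense, it is everything, and the
closed graph theorem applies (`MemChat.exists_eq_ofLinear_coe`).

For bounded `a`, points outside the Browder spectrum are isolated from the rest of the spectrum.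
Hence the spectrum in a small punctured disc about 0 is countable, some small circle misses it, and
the spectrum inside that circle is a suitable set (`exists_isSuitable`). Conversely, every suitable
set is the spectrum inside some circle lying in the resolvent set, so the Riesz integral gives its
projection `P`.

Since `0` is a spectral point only of the part of `a` in the range of `P`, the operator `a - ξP` is
invertible and `aB = 1 - P`. For nonzero `z`, `aP - z` is Fredholm: it is `-z` on the null space of
`P`, while on the range `z` is a Riesz point or a regular point. As the essential spectrum is
nonempty in infinite dimensions (Liouville in the Calkin quotient), `aP` is Riesz. The expansion of
the resolvent is a Neumann series in `z⁻¹aP` on the range of `P` and one in `zB` on its null space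
(`exists_laurent_hasSum`). -/

@[simp] theorem ofLinear_domain (T : E →ₗ[ℂ] E) : (ofLinear T).domain = ⊤ := rfl

@[simp] theorem ofLinear_apply (T : E →ₗ[ℂ] E) (x : (ofLinear T).domain) :
    ofLinear T x = T x := rfl

theorem mem_graph_ofLinear (T : E →ₗ[ℂ] E) (x y : E) :
    (x, y) ∈ (ofLinear T).graph ↔ T x = y := by
  rw [LinearPMap.mem_graph_iff]
  constructor
  · rintro ⟨u, rfl, rfl⟩
    rfl
  · intro h
    exact ⟨⟨x, trivial⟩, rfl, h⟩

theorem eq_ofLinear_of_domain_eq_top {A : E →ₗ.[ℂ] E} (h : A.domain = ⊤) (T : E →ₗ[ℂ] E)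
    (hT : ∀ x : A.domain, A x = T x) : A = ofLinear T :=
  LinearPMap.ext h fun x hx _ => hT ⟨x, hx⟩

theorem mem_pcomp_domain (g f : E →ₗ.[ℂ] E) (x : E) :
    x ∈ (pcomp g f).domain ↔ ∃ h : x ∈ f.domain, f ⟨x, h⟩ ∈ g.domain := by
  constructor
  · rintro ⟨⟨y, hy, rfl⟩, hx⟩
    exact ⟨hx, hy⟩
  · rintro ⟨h, hg⟩
    exact ⟨⟨⟨x, h⟩, hg, rfl⟩, h⟩

theorem pcomp_ofLinear (S T : E →ₗ[ℂ] E) :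
    pcomp (ofLinear S) (ofLinear T) = ofLinear (S ∘ₗ T) := by
  apply eq_ofLinear_of_domain_eq_top
  · ext x
    simp [mem_pcomp_domain]
  · intro x
    rfl

theorem pow_ofLinear (T : E →ₗ[ℂ] E) (n : ℕ) : pow (ofLinear T) n = ofLinear (T ^ n) := by
  induction n with
  | zero => rfl
  | succ n ih => rw [pow, ih, pcomp_ofLinear, pow_succ']; rfl

theorem subLinear_ofLinear (T S : E →ₗ[ℂ] E) : subLinear (ofLinear T) S = ofLinear (T - S) := by
  refine eq_ofLinear_of_domain_eq_top rfl _ fun x => ?_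
  change -S x + T x = T x - S x
  abel

theorem scalarSub_ofLinear (z : ℂ) (T : E →ₗ[ℂ] E) :
    scalarSub z (ofLinear T) = ofLinear (z • LinearMap.id - T) := by
  refine eq_ofLinear_of_domain_eq_top rfl _ fun x => ?_
  change z • (x : E) + -T x = z • (x : E) - T x
  abel

theorem nullSpace_ofLinear (T : E →ₗ[ℂ] E) : nullSpace (ofLinear T) = LinearMap.ker T := by
  ext x
  constructor
  · rintro ⟨y, hy, rfl⟩
    exact hy
  · intro h
    exact ⟨⟨x, trivial⟩, h, rfl⟩

theorem rangeSpace_ofLinear (T : E →ₗ[ℂ] E) : rangeSpace (ofLinear T) = LinearMap.range T := by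
  ext x
  constructor
  · rintro ⟨y, rfl⟩
    exact ⟨y, rfl⟩
  · rintro ⟨y, rfl⟩
    exact ⟨⟨y, trivial⟩, rfl⟩

theorem bijective_ofLinear (T : E →ₗ[ℂ] E) :
    Function.Bijective (ofLinear T) ↔ Function.Bijective T := by
  constructor
  · rintro ⟨h1, h2⟩
    refine ⟨fun x y hxy => ?_, fun y => ?_⟩
    · exact congrArg Subtype.val (@h1 ⟨x, trivial⟩ ⟨y, trivial⟩ hxy)
    · obtain ⟨x, hx⟩ := h2 y
      exact ⟨x, hx⟩
  · rintro ⟨h1, h2⟩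
    refine ⟨fun x y hxy => Subtype.ext (h1 hxy), fun y => ?_⟩
    obtain ⟨x, hx⟩ := h2 y
    exact ⟨⟨x, trivial⟩, hx⟩

theorem mem_resolventSet_ofLinear (z : ℂ) (T : E →ₗ[ℂ] E) :
    z ∈ resolventSet (ofLinear T) ↔
      Function.Bijective (z • LinearMap.id - T : E →ₗ[ℂ] E) := by
  rw [resolventSet, Set.mem_ofPred_eq, scalarSub_ofLinear, bijective_ofLinear]

theorem part_ofLinear (T : E →ₗ[ℂ] E) (M : Submodule ℂ E)
    (h : ∀ x : (ofLinear T).domain, (x : E) ∈ M → ofLinear T x ∈ M) :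
    part (ofLinear T) M h = ofLinear (T.restrict (p := M) (q := M) fun x hx => h ⟨x, trivial⟩ hx) := by
  refine eq_ofLinear_of_domain_eq_top ?_ _ fun x => ?_
  · ext x
    simp [part]
  · rfl

theorem mem_resolventSet_part_ofLinear (z : ℂ) (T : E →ₗ[ℂ] E) (M : Submodule ℂ E)
    (h : ∀ x : (ofLinear T).domain, (x : E) ∈ M → ofLinear T x ∈ M) :
    z ∈ resolventSet (part (ofLinear T) M h) ↔
      (∀ x ∈ M, z • x - T x = 0 → x = 0) ∧ ∀ y ∈ M, ∃ x ∈ M, z • x - T x = y := by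
  rw [part_ofLinear, mem_resolventSet_ofLinear, Function.Bijective,
    injective_iff_map_eq_zero]
  refine and_congr ⟨fun H x hx h0 => ?_, fun H x hx => ?_⟩ ⟨fun H y hy => ?_, fun H y => ?_⟩
  · simpa using H ⟨x, hx⟩ (Subtype.ext h0)
  · exact Subtype.ext (H x x.2 (congrArg Subtype.val hx))
  · obtain ⟨x, hx⟩ := H ⟨y, hy⟩
    exact ⟨x, x.2, congrArg Subtype.val hx⟩
  · obtain ⟨x, hx, hxy⟩ := H y y.2
    exact ⟨⟨x, hx⟩, Subtype.ext hxy⟩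

/-- The resolvent set of an everywhere defined operator is the intersection of the resolvent sets
of its parts in two complementary invariant subspaces. -/
theorem mem_resolventSet_iff_of_isCompl (z : ℂ) (T : E →ₗ[ℂ] E) {M N : Submodule ℂ E}
    (hMN : IsCompl M N)
    (hM : ∀ x : (ofLinear T).domain, (x : E) ∈ M → ofLinear T x ∈ M)
    (hN : ∀ x : (ofLinear T).domain, (x : E) ∈ N → ofLinear T x ∈ N) :
    z ∈ resolventSet (ofLinear T) ↔
      z ∈ resolventSet (part (ofLinear T) M hM) ∧ z ∈ resolventSet (part (ofLinear T) N hN) := by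
  have hM' : ∀ x ∈ M, z • x - T x ∈ M := fun x hx =>
    M.sub_mem (M.smul_mem _ hx) (hM ⟨x, trivial⟩ hx)
  have hN' : ∀ x ∈ N, z • x - T x ∈ N := fun x hx =>
    N.sub_mem (N.smul_mem _ hx) (hN ⟨x, trivial⟩ hx)
  have hdec : ∀ x, ∃ m ∈ M, ∃ n ∈ N, m + n = x := fun x =>
    Submodule.mem_sup.1 (hMN.sup_eq_top ▸ trivial)
  have huniq : ∀ m ∈ M, ∀ n ∈ N, m + n = 0 → m = 0 ∧ n = 0 := by
    intro m hm n hn h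
    have h1 : m = -n := eq_neg_of_add_eq_zero_left h
    have h2 : m = 0 := Submodule.disjoint_def.1 hMN.disjoint m hm (h1 ▸ N.neg_mem hn)
    exact ⟨h2, by simpa [h2] using h⟩
  rw [mem_resolventSet_part_ofLinear, mem_resolventSet_part_ofLinear, mem_resolventSet_ofLinear,
    Function.Bijective, injective_iff_map_eq_zero]
  constructor
  · rintro ⟨h1, h2⟩
    refine ⟨⟨fun x _ h => h1 x h, fun y hy => ?_⟩, ⟨fun x _ h => h1 x h, fun y hy => ?_⟩⟩
    · obtain ⟨x, hx⟩ := h2 y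
      obtain ⟨m, hm, n, hn, rfl⟩ := hdec x
      have hx' : (z • m - T m - y) + (z • n - T n) = 0 := by
        rw [← hx]
        simp only [LinearMap.sub_apply, LinearMap.smul_apply, LinearMap.id_apply, map_add]
        module
      have := (huniq _ (M.sub_mem (hM' m hm) hy) _ (hN' n hn) hx').1
      exact ⟨m, hm, sub_eq_zero.1 this⟩
    · obtain ⟨x, hx⟩ := h2 y
      obtain ⟨m, hm, n, hn, rfl⟩ := hdec x
      have hx' : (z • m - T m) + (z • n - T n - y) = 0 := by
        rw [← hx]
        simp only [LinearMap.sub_apply, LinearMap.smul_apply, LinearMap.id_apply, map_add]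
        module
      have := (huniq _ (hM' m hm) _ (N.sub_mem (hN' n hn) hy) hx').2
      exact ⟨n, hn, sub_eq_zero.1 this⟩
  · rintro ⟨⟨h1, h2⟩, h3, h4⟩
    refine ⟨fun x hx => ?_, fun y => ?_⟩
    · obtain ⟨m, hm, n, hn, rfl⟩ := hdec x
      have hx' : (z • m - T m) + (z • n - T n) = 0 := by
        rw [← hx]
        simp only [LinearMap.sub_apply, LinearMap.smul_apply, LinearMap.id_apply, map_add]
      obtain ⟨e1, e2⟩ := huniq _ (hM' m hm) _ (hN' n hn) hx'
      rw [h1 m hm e1, h3 n hn e2, add_zero]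
    · obtain ⟨m, hm, n, hn, rfl⟩ := hdec y
      obtain ⟨u, hu, e1⟩ := h2 m hm
      obtain ⟨v, hv, e2⟩ := h4 n hn
      refine ⟨u + v, ?_⟩
      rw [← e1, ← e2]
      simp only [LinearMap.sub_apply, LinearMap.smul_apply, LinearMap.id_apply, map_add]

end Algebraic

/-! ### Bounded operators: spectra and closed ranges -/

section Bounded

variable {X : Type*} [NormedAddCommGroup X] [NormedSpace ℂ X]

theorem isBoundedProd_ofLinear (a B : X →L[ℂ] X) :
    IsBoundedProd (ofLinear (a : X →ₗ[ℂ] X)) B :=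
  ⟨a ∘L B, fun _ => (mem_graph_ofLinear _ _ _).2 rfl⟩

theorem prodL_ofLinear (a B : X →L[ℂ] X) : prodL (ofLinear (a : X →ₗ[ℂ] X)) B = a * B := by
  have h := isBoundedProd_ofLinear a B
  rw [prodL, dif_pos h]
  ext x
  exact ((mem_graph_ofLinear _ _ _).1 (h.choose_spec x)).symm

theorem pow_ofLinear_coe (a : X →L[ℂ] X) (n : ℕ) :
    pow (ofLinear (a : X →ₗ[ℂ] X)) n = ofLinear ((a ^ n : X →L[ℂ] X) : X →ₗ[ℂ] X) := by
  rw [pow_ofLinear, ContinuousLinearMap.toLinearMap_pow]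

theorem subLinear_ofLinear_smul (a : X →L[ℂ] X) (z : ℂ) :
    subLinear (ofLinear (a : X →ₗ[ℂ] X)) (z • LinearMap.id) =
      ofLinear ((a - z • 1 : X →L[ℂ] X) : X →ₗ[ℂ] X) :=
  subLinear_ofLinear _ _

variable [CompleteSpace X]

theorem mem_resolventSet_ofLinear_coe (a : X →L[ℂ] X) (z : ℂ) :
    z ∈ resolventSet (ofLinear (a : X →ₗ[ℂ] X)) ↔ z ∈ _root_.resolventSet ℂ a := by
  rw [mem_resolventSet_ofLinear, spectrum.mem_resolventSet_iff,
    ContinuousLinearMap.isUnit_iff_bijective]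
  rfl

theorem spec_ofLinear_coe (a : X →L[ℂ] X) : spec (ofLinear (a : X →ₗ[ℂ] X)) = spectrum ℂ a := by
  ext z
  rw [spec, Set.mem_compl_iff, mem_resolventSet_ofLinear_coe]
  rfl

/-- A bounded operator between Banach spaces whose range has a closed algebraic complement has
closed range. -/
theorem isClosed_range_of_isCompl {Y : Type*} [NormedAddCommGroup Y]
    [NormedSpace ℂ Y] [CompleteSpace Y] (f : Y →L[ℂ] X) {Z : Submodule ℂ X}
    (hZ : IsCompl (LinearMap.range (f : Y →ₗ[ℂ] X)) Z) (hZc : IsClosed (Z : Set X)) :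
    IsClosed (LinearMap.range (f : Y →ₗ[ℂ] X) : Set X) := by
  have hk : IsClosed (LinearMap.ker (f : Y →ₗ[ℂ] X) : Set Y) := f.isClosed_ker
  have : CompleteSpace Z := hZc.completeSpace_coe
  -- Dividing out the null space makes the map injective without changing its range.
  let g : (Y ⧸ LinearMap.ker (f : Y →ₗ[ℂ] X)) →L[ℂ] X :=
    Submodule.liftQL _ f le_rfl
  have hg : LinearMap.range g.toLinearMap = LinearMap.range (f : Y →ₗ[ℂ] X) :=
    Submodule.range_liftQ _ _ _
  have hker : LinearMap.ker g.toLinearMap = ⊥ := Submodule.ker_liftQ_eq_bot _ _ _ le_rfl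
  rw [← hg] at hZ ⊢
  exact g.closed_complemented_range_of_isCompl_of_ker_eq_bot Z hZ hZc hker

/-- A bounded operator between Banach spaces whose range has finite codimension has closed
range. -/
theorem isClosed_range_of_finiteDimensional_quotient {Y : Type*} [NormedAddCommGroup Y]
    [NormedSpace ℂ Y] [CompleteSpace Y] (f : Y →L[ℂ] X)
    [FiniteDimensional ℂ (X ⧸ LinearMap.range (f : Y →ₗ[ℂ] X))] :
    IsClosed (LinearMap.range (f : Y →ₗ[ℂ] X) : Set X) := by
  obtain ⟨Z, hZ⟩ := Submodule.exists_isCompl (LinearMap.range (f : Y →ₗ[ℂ] X))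
  have : FiniteDimensional ℂ Z :=
    LinearEquiv.finiteDimensional (Submodule.quotientEquivOfIsCompl _ Z hZ)
  exact isClosed_range_of_isCompl f hZ Z.closed_of_finiteDimensional

theorem isFredholm_ofLinear_coe_iff (a : X →L[ℂ] X) :
    IsFredholm (ofLinear (a : X →ₗ[ℂ] X)) ↔
      FiniteDimensional ℂ (LinearMap.ker (a : X →ₗ[ℂ] X)) ∧
      FiniteDimensional ℂ (X ⧸ LinearMap.range (a : X →ₗ[ℂ] X)) := by
  constructor
  · rintro ⟨h1, h2, h3⟩
    rw [nullSpace_ofLinear] at h2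
    rw [rangeSpace_ofLinear] at h3
    exact ⟨h2, h3⟩
  · rintro ⟨h2, h3⟩
    refine ⟨?_, ?_, ?_⟩
    · rw [rangeSpace_ofLinear]
      exact isClosed_range_of_finiteDimensional_quotient a
    · rwa [nullSpace_ofLinear]
    · rwa [rangeSpace_ofLinear]

end Bounded

/-! ### The hypotheses force the operator to be bounded -/

section EverywhereDefined

section Domains

variable {E : Type*} [AddCommGroup E] [Module ℂ E] (A : E →ₗ.[ℂ] E)

theorem pow_succ_domain_le (n : ℕ) : (pow A (n + 1)).domain ≤ (pow A n).domain :=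
  fun x hx => ((mem_pcomp_domain _ _ x).1 hx).1

theorem pow_succ_apply (n : ℕ) {x : E} (hx : x ∈ (pow A (n + 1)).domain)
    (hx' : x ∈ (pow A n).domain) (h : pow A n ⟨x, hx'⟩ ∈ A.domain) :
    pow A (n + 1) ⟨x, hx⟩ = A ⟨pow A n ⟨x, hx'⟩, h⟩ := rfl

/-- `D(Aⁿ⁺¹) = {x ∈ D(A) : A x ∈ D(Aⁿ)}`, with `Aⁿ⁺¹ x = Aⁿ (A x)`. -/
theorem mem_pow_succ_domain_iff (n : ℕ) (x : E) :
    (x ∈ (pow A (n + 1)).domain ↔ ∃ h : x ∈ A.domain, A ⟨x, h⟩ ∈ (pow A n).domain) ∧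
    ∀ (h : x ∈ A.domain) (h' : A ⟨x, h⟩ ∈ (pow A n).domain) (hx : x ∈ (pow A (n + 1)).domain),
      pow A (n + 1) ⟨x, hx⟩ = pow A n ⟨A ⟨x, h⟩, h'⟩ := by
  induction n with
  | zero =>
    refine ⟨?_, fun _ _ _ => rfl⟩
    refine (mem_pcomp_domain _ _ x).trans ?_
    exact ⟨fun ⟨_, h⟩ => ⟨h, trivial⟩, fun ⟨h, _⟩ => ⟨trivial, h⟩⟩
  | succ n ih =>
    constructor
    · constructor
      · intro hx
        obtain ⟨h1, h2⟩ := (mem_pcomp_domain _ _ x).1 hx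
        obtain ⟨h3, h4⟩ := ih.1.1 h1
        refine ⟨h3, (mem_pcomp_domain _ _ _).2 ⟨h4, ?_⟩⟩
        rw [← ih.2 h3 h4 h1]
        exact h2
      · rintro ⟨h3, h5⟩
        obtain ⟨h4, h6⟩ := (mem_pcomp_domain _ _ _).1 h5
        have h1 := ih.1.2 ⟨h3, h4⟩
        refine (mem_pcomp_domain _ _ _).2 ⟨h1, ?_⟩
        rw [ih.2 h3 h4 h1]
        exact h6
    · intro h3 h5 hx
      obtain ⟨h4, h6⟩ := (mem_pcomp_domain _ _ _).1 h5
      obtain ⟨h1, h2⟩ := (mem_pcomp_domain _ _ x).1 hx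
      rw [pow_succ_apply A (n + 1) hx h1 h2, pow_succ_apply A n h5 h4 h6]
      congr 2
      exact ih.2 h3 h4 h1

/-- The term `z • x` is harmless: `x` lies in `D(Aⁿ)` on both sides, in the backward direction by
climbing one power at a time. So the Fredholm shift of `A` can replace `A` when domains of powers
are compared. -/
theorem mem_pow_succ_domain_iff_sub (z : ℂ) (n : ℕ) (x : A.domain) :
    (x : E) ∈ (pow A (n + 1)).domain ↔ A x - z • (x : E) ∈ (pow A n).domain := by
  have key : (x : E) ∈ (pow A (n + 1)).domain ↔ A x ∈ (pow A n).domain := by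
    rw [(mem_pow_succ_domain_iff A n x).1]
    exact ⟨fun ⟨_, h⟩ => h, fun h => ⟨x.2, h⟩⟩
  constructor
  · intro h
    exact Submodule.sub_mem _ (key.1 h) (Submodule.smul_mem _ _ (pow_succ_domain_le A n h))
  · intro h
    have hx : (x : E) ∈ (pow A n).domain := by
      clear key
      induction n with
      | zero => trivial
      | succ n ih =>
        have h1 := pow_succ_domain_le A n h
        have h2 := ih h1
        rw [(mem_pow_succ_domain_iff A n x).1]
        exact ⟨x.2, by simpa using Submodule.add_mem _ h1 (Submodule.smul_mem _ z h2)⟩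
    exact key.2 (by simpa using Submodule.add_mem _ h (Submodule.smul_mem _ z hx))

/-- A complement of `D ⊓ R` in `D` embeds in `E ⧸ R`. -/
theorem exists_finiteDimensional_le_inf_sup (D R : Submodule ℂ E)
    [FiniteDimensional ℂ (E ⧸ R)] :
    ∃ W : Submodule ℂ E, FiniteDimensional ℂ W ∧ D ≤ (D ⊓ R) ⊔ W := by
  obtain ⟨V, hV⟩ := Submodule.exists_isCompl (R.comap D.subtype)
  have hinj : Function.Injective (R.mkQ ∘ₗ D.subtype ∘ₗ V.subtype) := by
    rw [← LinearMap.ker_eq_bot, LinearMap.ker_eq_bot']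
    intro v hv
    have h1 : (v : D) ∈ R.comap D.subtype := by
      simpa [Submodule.Quotient.mk_eq_zero] using hv
    exact Subtype.ext (Submodule.disjoint_def.1 hV.disjoint _ h1 v.2)
  have : FiniteDimensional ℂ V := FiniteDimensional.of_injective _ hinj
  refine ⟨V.map D.subtype, inferInstance, fun x hx => ?_⟩
  obtain ⟨r, hr, v, hv, h⟩ := Submodule.mem_sup.1
    (hV.sup_eq_top ▸ trivial : (⟨x, hx⟩ : D) ∈ R.comap D.subtype ⊔ V)
  refine Submodule.mem_sup.2 ⟨r, ⟨r.2, hr⟩, v, ⟨v, hv, rfl⟩, congrArg Subtype.val h⟩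

/-- If `A - z` has range of finite codimension and the domains of the powers of `A` stabilize, then
the domain of `A` has finite codimension. -/
theorem exists_finiteDimensional_domain_sup_eq_top (z : ℂ)
    [FiniteDimensional ℂ (E ⧸ rangeSpace (subLinear A (z • LinearMap.id)))]
    {J : ℕ} (hJ : (pow A (J + 1)).domain = (pow A J).domain) :
    ∃ W : Submodule ℂ E, FiniteDimensional ℂ W ∧ A.domain ⊔ W = ⊤ := by
  let T : A.domain →ₗ[ℂ] E := A.toFun - z • A.domain.subtype
  have hT : ∀ x : A.domain, T x = A x - z • (x : E) := fun _ => rfl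
  have hR : rangeSpace (subLinear A (z • LinearMap.id)) = LinearMap.range T := by
    have h : (subLinear A (z • LinearMap.id)).toFun = T := by
      ext x
      change -(z • (x : E)) + A x = A x - z • (x : E)
      abel
    rw [rangeSpace, h]
    rfl
  have : FiniteDimensional ℂ (E ⧸ LinearMap.range T) := hR ▸ inferInstance
  -- Descent in `j`, started below at `J` with `W = ⊥`. Up to finite dimension, an element of
  -- `D(A^j)` is `T x` with `x ∈ D(A^(j+1))`. Splitting `x` by the hypothesis and applying `T` loses
  -- one power and only a finite-dimensional piece.
  have key : ∀ j, (∃ W : Submodule ℂ E, FiniteDimensional ℂ W ∧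
      (pow A j).domain ≤ (pow A (j + 1)).domain ⊔ W) →
      ∃ W : Submodule ℂ E, FiniteDimensional ℂ W ∧
        (pow A 0).domain ≤ (pow A 1).domain ⊔ W := by
    intro j
    induction j with
    | zero => exact id
    | succ j ih =>
      rintro ⟨W, hW, hle⟩
      apply ih
      obtain ⟨V, hV, hVle⟩ :=
        exists_finiteDimensional_le_inf_sup (pow A j).domain (LinearMap.range T)
      -- `W` need not lie in the domain of `T`, but the component `w = x - d` used below does, so
      -- `W` may be cut down.
      let W' : Submodule ℂ A.domain := (W ⊓ (pow A (j + 1)).domain).comap A.domain.subtype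
      have hW' : FiniteDimensional ℂ W' := by
        have : FiniteDimensional ℂ (W ⊓ (pow A (j + 1)).domain : Submodule ℂ E) :=
          Submodule.finiteDimensional_of_le inf_le_left
        exact FiniteDimensional.of_injective
          ((A.domain.subtype).restrict (p := W') (q := W ⊓ (pow A (j + 1)).domain)
            fun x hx => hx) fun x y hxy => Subtype.ext <| Subtype.ext <|
              congrArg (fun u : (W ⊓ (pow A (j + 1)).domain : Submodule ℂ E) => (u : E)) hxy
      refine ⟨W'.map T ⊔ V, Submodule.finiteDimensional_sup _ _, fun y hy => ?_⟩
      obtain ⟨r, ⟨hr1, x, rfl⟩, v, hv, rfl⟩ := Submodule.mem_sup.1 (hVle hy)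
      have hx : (x : E) ∈ (pow A (j + 1)).domain := by
        rw [mem_pow_succ_domain_iff_sub A z j x, ← hT]
        exact hr1
      obtain ⟨d, hd, w, hw, hdw⟩ := Submodule.mem_sup.1 (hle hx)
      have hdA : d ∈ A.domain := ((mem_pow_succ_domain_iff A _ d).1.1 hd).1
      have hwx : w = x - d := by rw [← hdw]; abel
      have hwA : w ∈ A.domain := hwx ▸ Submodule.sub_mem _ x.2 hdA
      have hwD : w ∈ (pow A (j + 1)).domain :=
        hwx ▸ Submodule.sub_mem _ hx (pow_succ_domain_le A _ hd)
      have hTx : T x = T ⟨d, hdA⟩ + T ⟨w, hwA⟩ := by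
        rw [← map_add]
        congr 1
        exact Subtype.ext hdw.symm
      rw [hTx]
      have h1 : T ⟨d, hdA⟩ ∈ (pow A (j + 1)).domain := by
        rw [hT, ← mem_pow_succ_domain_iff_sub A z (j + 1) ⟨d, hdA⟩]
        exact hd
      have h2 : T ⟨w, hwA⟩ ∈ W'.map T := ⟨⟨w, hwA⟩, ⟨hw, hwD⟩, rfl⟩
      rw [add_assoc]
      exact Submodule.add_mem_sup h1 (Submodule.add_mem_sup h2 hv)
  obtain ⟨W, hW, h⟩ := key J ⟨⊥, inferInstance, by rw [hJ]; exact le_sup_left⟩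
  refine ⟨W, hW, top_le_iff.1 fun x _ => ?_⟩
  have h1 : (pow A 1).domain ≤ A.domain := fun x hx => ((mem_pow_succ_domain_iff A 0 x).1.1 hx).1
  exact sup_le_sup_right h1 W (h (show x ∈ (pow A 0).domain from trivial))

end Domains

variable {X : Type*} [NormedAddCommGroup X] [NormedSpace ℂ X] [CompleteSpace X]

/-- A closed densely defined operator whose domain has finite codimension is everywhere defined
and bounded. -/
theorem exists_eq_ofLinear_coe {A : X →ₗ.[ℂ] X} (hc : A.IsClosed)
    (hd : Dense (A.domain : Set X)) {W : Submodule ℂ X} [FiniteDimensional ℂ W]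
    (hW : A.domain ⊔ W = ⊤) : ∃ a : X →L[ℂ] X, A = ofLinear (a : X →ₗ[ℂ] X) := by
  have : CompleteSpace A.graph := IsClosed.completeSpace_coe (hs := hc)
  -- The graph is a Banach space and `D(A)` is the range of its first projection, so finite
  -- codimension makes `D(A)` closed.
  let f : A.graph →L[ℂ] X := (ContinuousLinearMap.fst ℂ X X) ∘L A.graph.subtypeL
  have hf : LinearMap.range (f : A.graph →ₗ[ℂ] X) = A.domain := by
    ext x
    constructor
    · rintro ⟨⟨⟨u, v⟩, h⟩, rfl⟩
      exact LinearPMap.mem_domain_of_mem_graph h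
    · intro h
      exact ⟨⟨(x, A ⟨x, h⟩), A.mem_graph ⟨x, h⟩⟩, rfl⟩
  have hfd : FiniteDimensional ℂ (X ⧸ LinearMap.range (f : A.graph →ₗ[ℂ] X)) := by
    rw [hf]
    refine FiniteDimensional.of_surjective (A.domain.mkQ ∘ₗ W.subtype) fun q => ?_
    obtain ⟨x, rfl⟩ := A.domain.mkQ_surjective q
    obtain ⟨d, hd, w, hw, rfl⟩ := Submodule.mem_sup.1 (hW ▸ trivial : x ∈ A.domain ⊔ W)
    refine ⟨⟨w, hw⟩, ?_⟩
    have : A.domain.mkQ d = 0 := by simpa using hd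
    simp only [LinearMap.comp_apply, Submodule.subtype_apply, map_add, this, zero_add]
  have hclosed := isClosed_range_of_finiteDimensional_quotient f
  rw [hf] at hclosed
  have htop : A.domain = ⊤ := by
    refine SetLike.coe_injective ?_
    rw [← hclosed.closure_eq, hd.closure_eq]
    rfl
  let T : X →ₗ[ℂ] X := A.toFun ∘ₗ (LinearMap.id.codRestrict A.domain fun x => htop ▸ trivial)
  have hA : A = ofLinear T := eq_ofLinear_of_domain_eq_top htop T fun _ => rfl
  have hg : IsClosed (T.graph : Set (X × X)) := by
    have h1 : T.graph = A.graph := by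
      ext ⟨x, y⟩
      rw [hA, mem_graph_ofLinear, LinearMap.mem_graph_iff]
      exact eq_comm
    rw [h1]
    exact hc
  exact ⟨ContinuousLinearMap.ofIsClosedGraph hg, hA⟩

theorem MemChat.exists_eq_ofLinear_coe {A : X →ₗ.[ℂ] X} (hA : MemChat A) :
    ∃ a : X →L[ℂ] X, A = ofLinear (a : X →ₗ[ℂ] X) := by
  obtain ⟨z, hz⟩ := hA.essResolvent_nonempty
  have hF : IsFredholm (subLinear A (z • LinearMap.id)) := not_not.1 hz
  have := hF.finite_codim
  obtain ⟨J, hJ⟩ := hA.domain_stabilizes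
  obtain ⟨W, hW, h⟩ := exists_finiteDimensional_domain_sup_eq_top A z (hJ J le_rfl)
  exact ClosedOp.exists_eq_ofLinear_coe hA.isClosed hA.dense_domain h

end EverywhereDefined

/-! ### Isolation of Riesz points and existence of suitable sets -/

section Isolated

section AscentDescent

variable {E : Type*} [AddCommGroup E] [Module ℂ E]

theorem ker_pow_add_eq {T : E →ₗ[ℂ] E} {n : ℕ}
    (h : LinearMap.ker (T ^ n) = LinearMap.ker (T ^ (n + 1))) (k : ℕ) :
    LinearMap.ker (T ^ (n + k)) = LinearMap.ker (T ^ n) := by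
  induction k with
  | zero => rfl
  | succ k ih =>
    ext x
    have h1 : x ∈ LinearMap.ker (T ^ (n + (k + 1))) ↔ T x ∈ LinearMap.ker (T ^ (n + k)) := by
      rw [LinearMap.mem_ker, LinearMap.mem_ker, ← add_assoc, pow_succ]
      rfl
    have h2 : x ∈ LinearMap.ker (T ^ (n + 1)) ↔ T x ∈ LinearMap.ker (T ^ n) := by
      rw [LinearMap.mem_ker, LinearMap.mem_ker, pow_succ]
      rfl
    rw [h1, ih, ← h2, h]

theorem range_pow_add_eq {T : E →ₗ[ℂ] E} {n : ℕ}
    (h : LinearMap.range (T ^ n) = LinearMap.range (T ^ (n + 1))) (k : ℕ) :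
    LinearMap.range (T ^ (n + k)) = LinearMap.range (T ^ n) := by
  have hs : ∀ m, LinearMap.range (T ^ (m + 1)) = (LinearMap.range (T ^ m)).map T := by
    intro m
    rw [pow_succ']
    exact LinearMap.range_comp _ _
  induction k with
  | zero => rfl
  | succ k ih => rw [← add_assoc, hs, ih, ← hs, ← h]

/-- An operator of finite ascent and descent splits the space into the null space and the range
of one of its powers, on which it acts bijectively. -/
theorem exists_isCompl_ker_pow_range_pow {T : E →ₗ[ℂ] E}
    (ha : ∃ n : ℕ, LinearMap.ker (T ^ n) = LinearMap.ker (T ^ (n + 1)))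
    (hd : ∃ n : ℕ, LinearMap.range (T ^ n) = LinearMap.range (T ^ (n + 1))) :
    ∃ p : ℕ, IsCompl (LinearMap.ker (T ^ p)) (LinearMap.range (T ^ p)) ∧
      (∀ x ∈ LinearMap.range (T ^ p), T x = 0 → x = 0) ∧
      ∀ y ∈ LinearMap.range (T ^ p), ∃ x ∈ LinearMap.range (T ^ p), T x = y := by
  obtain ⟨n, hn⟩ := ha
  obtain ⟨m, hm⟩ := hd
  -- The exponent `n + m` bounds both ascent and descent, so both chains are constant from there on.
  have hk : ∀ k, LinearMap.ker (T ^ (n + m + k)) = LinearMap.ker (T ^ (n + m)) := by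
    intro k
    rw [ker_pow_add_eq hn m, add_assoc, ker_pow_add_eq hn]
  have hr : ∀ k, LinearMap.range (T ^ (n + m + k)) = LinearMap.range (T ^ (n + m)) := by
    intro k
    rw [add_comm n m, range_pow_add_eq hm n, add_assoc, range_pow_add_eq hm]
  have hpp : ∀ x, (T ^ (n + m + (n + m))) x = (T ^ (n + m)) ((T ^ (n + m)) x) := by
    intro x
    rw [pow_add T (n + m)]
    rfl
  refine ⟨n + m, ⟨?_, ?_⟩, ?_, ?_⟩
  · rw [Submodule.disjoint_def]
    rintro _ hx ⟨x, rfl⟩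
    rw [LinearMap.mem_ker, ← hpp, ← LinearMap.mem_ker, hk] at hx
    exact hx
  · rw [codisjoint_iff_le_sup]
    intro x _
    have hx : (T ^ (n + m)) x ∈ LinearMap.range (T ^ (n + m + (n + m))) := by
      rw [hr]
      exact ⟨x, rfl⟩
    obtain ⟨y, hy⟩ := hx
    refine Submodule.mem_sup.2 ⟨x - (T ^ (n + m)) y, ?_, (T ^ (n + m)) y, ⟨y, rfl⟩, by abel⟩
    rw [LinearMap.mem_ker, map_sub, ← hpp, hy, sub_self]
  · rintro _ ⟨x, rfl⟩ hx
    have : x ∈ LinearMap.ker (T ^ (n + m + 1)) := by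
      rw [LinearMap.mem_ker, pow_succ']
      exact hx
    rwa [hk] at this
  · intro y hy
    rw [← hr 1] at hy
    obtain ⟨x, rfl⟩ := hy
    exact ⟨(T ^ (n + m)) x, ⟨x, rfl⟩, by rw [pow_succ' T (n + m)]; rfl⟩

end AscentDescent

variable {X : Type*} [NormedAddCommGroup X] [NormedSpace ℂ X] [CompleteSpace X]

theorem eventually_mem_resolventSet_of_bijective {c : X →L[ℂ] X} (hc : Function.Bijective c) :
    ∀ᶠ z in 𝓝 (0 : ℂ), z ∈ resolventSet (ofLinear (c : X →ₗ[ℂ] X)) := by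
  have h0 : (0 : ℂ) ∈ _root_.resolventSet ℂ c := by
    rw [spectrum.mem_resolventSet_iff, map_zero, zero_sub, IsUnit.neg_iff]
    exact ContinuousLinearMap.isUnit_iff_bijective.2 hc
  filter_upwards [(spectrum.isOpen_resolventSet c).mem_nhds h0] with z hz
  exact (mem_resolventSet_ofLinear_coe c z).2 hz

theorem eventually_mem_resolventSet_part (b : X →L[ℂ] X) {N : Submodule ℂ X}
    (hNc : IsClosed (N : Set X))
    (hN : ∀ x : (ofLinear (b : X →ₗ[ℂ] X)).domain, (x : X) ∈ N →
      ofLinear (b : X →ₗ[ℂ] X) x ∈ N)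
    (hinj : ∀ x ∈ N, b x = 0 → x = 0) (hsurj : ∀ y ∈ N, ∃ x ∈ N, b x = y) :
    ∀ᶠ z in 𝓝 (0 : ℂ), z ∈ resolventSet (part (ofLinear (b : X →ₗ[ℂ] X)) N hN) := by
  have : CompleteSpace N := hNc.completeSpace_coe
  rw [part_ofLinear]
  refine eventually_mem_resolventSet_of_bijective
    (c := b.restrict (fun x hx => hN ⟨x, trivial⟩ hx : Set.MapsTo b N N)) ⟨?_, fun y => ?_⟩
  · rw [injective_iff_map_eq_zero]
    intro x hx
    exact Subtype.ext (hinj x x.2 (congrArg Subtype.val hx))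
  · obtain ⟨x, hx, hxy⟩ := hsurj y y.2
    exact ⟨⟨x, hx⟩, Subtype.ext hxy⟩

/-- The space splits into `ker b^p`, where `b` is nilpotent and `z - b` is invertible for every `z ≠
0`, and `ran b^p`, where `b` is invertible and hence so is `z - b` for small `z`. -/
theorem eventually_mem_resolventSet_of_isBrowder {b : X →L[ℂ] X}
    (hb : IsBrowder (ofLinear (b : X →ₗ[ℂ] X))) :
    ∀ᶠ z in 𝓝[≠] (0 : ℂ), z ∈ resolventSet (ofLinear (b : X →ₗ[ℂ] X)) := by
  have ha := hb.finite_ascent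
  have hd := hb.finite_descent
  simp only [pow_ofLinear, nullSpace_ofLinear, rangeSpace_ofLinear] at ha hd
  obtain ⟨p, hc, hinj, hsurj⟩ := exists_isCompl_ker_pow_range_pow ha hd
  let T : X →ₗ[ℂ] X := b
  have hcoe : ((b ^ p : X →L[ℂ] X) : X →ₗ[ℂ] X) = T ^ p :=
    ContinuousLinearMap.toLinearMap_pow b p
  have hKc : IsClosed (LinearMap.ker (T ^ p) : Set X) := by
    rw [← hcoe]
    exact (b ^ p).isClosed_ker
  -- The range is closed because its algebraic complement `ker b^p` is.
  have hNc : IsClosed (LinearMap.range (T ^ p) : Set X) := by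
    have := isClosed_range_of_isCompl (b ^ p) (Z := LinearMap.ker (T ^ p))
      (by rw [hcoe]; exact hc.symm) hKc
    rwa [hcoe] at this
  have hcomm : ∀ x, (T ^ p) (T x) = T ((T ^ p) x) := fun x => by
    change (T ^ p * T) x = (T * T ^ p) x
    rw [pow_mul_comm']
  have hK : ∀ x : (ofLinear T).domain, (x : X) ∈ LinearMap.ker (T ^ p) →
      ofLinear T x ∈ LinearMap.ker (T ^ p) := by
    intro x hx
    rw [LinearMap.mem_ker] at hx ⊢
    rw [ofLinear_apply, hcomm, hx, map_zero]
  have hN : ∀ x : (ofLinear T).domain, (x : X) ∈ LinearMap.range (T ^ p) →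
      ofLinear T x ∈ LinearMap.range (T ^ p) := by
    rintro x ⟨y, hy⟩
    exact ⟨T y, by rw [hcomm, hy]; rfl⟩
  have hopen := nhdsWithin_le_nhds (s := {0}ᶜ)
    (eventually_mem_resolventSet_part b hNc hN hinj hsurj)
  filter_upwards [hopen, self_mem_nhdsWithin] with z hz hz0
  rw [mem_resolventSet_iff_of_isCompl z T hc hK hN]
  constructor
  · rw [part_ofLinear, mem_resolventSet_ofLinear]
    set S := T.restrict (p := LinearMap.ker (T ^ p)) (q := LinearMap.ker (T ^ p))
      fun x hx => hK ⟨x, trivial⟩ hx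
    have hS : IsNilpotent S := by
      refine ⟨p, ?_⟩
      ext x
      have h1 : ∀ k, (((S ^ k) x : LinearMap.ker (T ^ p)) : X) = (T ^ k) x := by
        intro k
        induction k with
        | zero => rfl
        | succ k ih =>
          rw [pow_succ', pow_succ', Module.End.mul_apply, Module.End.mul_apply, ← ih]
          rfl
      rw [h1]
      exact x.2
    rw [← Module.End.isUnit_iff]
    have hu : IsUnit (z • (LinearMap.id : Module.End ℂ (LinearMap.ker (T ^ p)))) :=
      (IsUnit.mk0 z hz0).map (algebraMap ℂ (Module.End ℂ (LinearMap.ker (T ^ p))))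
    rw [sub_eq_add_neg]
    exact hS.neg.isUnit_add_left_of_commute hu (Commute.smul_right (Commute.one_right _) _)
  · exact hz

theorem eventually_mem_resolventSet_of_notMem_browderSpec {a : X →L[ℂ] X} {z : ℂ}
    (hz : z ∉ browderSpec (ofLinear (a : X →ₗ[ℂ] X))) :
    ∀ᶠ w in 𝓝[≠] z, w ∈ resolventSet (ofLinear (a : X →ₗ[ℂ] X)) := by
  have hb : IsBrowder (ofLinear ((a - z • 1 : X →L[ℂ] X) : X →ₗ[ℂ] X)) := by
    rw [← subLinear_ofLinear_smul]
    exact not_not.1 hz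
  have h1 := eventually_mem_resolventSet_of_isBrowder hb
  have h2 : Tendsto (fun w => w - z) (𝓝[≠] z) (𝓝[≠] 0) := by
    refine tendsto_nhdsWithin_iff.2 ⟨?_, ?_⟩
    · have : ContinuousAt (fun w => w - z) z := by fun_prop
      simpa using this.tendsto.mono_left nhdsWithin_le_nhds
    · filter_upwards [self_mem_nhdsWithin] with w hw
      exact sub_ne_zero.2 hw
  filter_upwards [h2.eventually h1] with w hw
  rw [mem_resolventSet_ofLinear] at hw ⊢
  have h : (w - z) • LinearMap.id - ((a - z • 1 : X →L[ℂ] X) : X →ₗ[ℂ] X) =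
      w • LinearMap.id - (a : X →ₗ[ℂ] X) := by
    ext x
    change (w - z) • x - (a x - z • x) = w • x - a x
    module
  rwa [h] at hw

theorem browderSpec_subset_spec (a : X →L[ℂ] X) :
    browderSpec (ofLinear (a : X →ₗ[ℂ] X)) ⊆ spec (ofLinear (a : X →ₗ[ℂ] X)) := by
  intro z hz hres
  apply hz
  rw [subLinear_ofLinear_smul]
  have hbij : Function.Bijective ((a - z • 1 : X →L[ℂ] X) : X →ₗ[ℂ] X) := by
    have h := (mem_resolventSet_ofLinear_coe a z).1 hres
    rw [spectrum.mem_resolventSet_iff, ← IsUnit.neg_iff, neg_sub,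
      ContinuousLinearMap.isUnit_iff_bijective] at h
    exact h
  have hk := LinearMap.ker_eq_bot.2 hbij.1
  have hr := LinearMap.range_eq_top.2 hbij.2
  refine ⟨?_, ⟨0, ?_⟩, ⟨0, ?_⟩⟩
  · rw [isFredholm_ofLinear_coe_iff, hk, hr]
    exact ⟨inferInstance, inferInstance⟩
  · simp only [pow_ofLinear, nullSpace_ofLinear]
    rw [zero_add, pow_one, hk, pow_zero]
    exact LinearMap.ker_id
  · simp only [pow_ofLinear, rangeSpace_ofLinear]
    rw [zero_add, pow_one, hr, pow_zero]
    exact LinearMap.range_id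

/-- The part of the spectrum in a disc whose boundary lies in the resolvent set is a bounded
spectral set. -/
theorem isBoundedSpectralSet_inter_ball (a : X →L[ℂ] X) (r : ℝ)
    (hr : ∀ z ∈ spectrum ℂ a, ‖z‖ ≠ r) :
    IsBoundedSpectralSet (ofLinear (a : X →ₗ[ℂ] X)) (spectrum ℂ a ∩ Metric.ball 0 r) := by
  have hb : Bornology.IsBounded (spectrum ℂ a ∩ Metric.ball 0 r) :=
    Metric.isBounded_ball.subset Set.inter_subset_right
  -- No spectral point lies on the circle, so the closed disc (for closedness) and the open disc
  -- (for openness) cut out the same set.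
  have hcl : spectrum ℂ a ∩ Metric.ball 0 r = spectrum ℂ a ∩ Metric.closedBall 0 r := by
    ext z
    simp only [Set.mem_inter_iff, mem_ball_zero_iff, mem_closedBall_zero_iff]
    exact and_congr_right fun h => ⟨le_of_lt, fun h' => lt_of_le_of_ne h' (hr z h)⟩
  refine ⟨hb, ?_, ?_, ?_⟩
  · rintro _ ⟨z, hz, rfl⟩
    exact Or.inl ⟨z, by rw [spec_ofLinear_coe]; exact hz.1, rfl⟩
  · have hcomp : IsCompact (spectrum ℂ a ∩ Metric.ball 0 r) := by
      rw [hcl]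
      exact (spectrum.isCompact a).inter_right Metric.isClosed_closedBall
    exact (hcomp.image OnePoint.continuous_coe).isClosed.preimage continuous_subtype_val
  · have ho : IsOpen (((↑) : ℂ → OnePoint ℂ) '' Metric.ball 0 r) :=
      OnePoint.isOpenEmbedding_coe.isOpenMap _ Metric.isOpen_ball
    convert ho.preimage continuous_subtype_val using 1
    ext ⟨x, hx⟩
    simp only [Set.mem_preimage]
    constructor
    · rintro ⟨z, hz, rfl⟩
      exact ⟨z, hz.2, rfl⟩
    · rintro ⟨z, hz, rfl⟩
      refine ⟨z, ⟨?_, hz⟩, rfl⟩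
      rcases hx with ⟨w, hw, hwz⟩ | h
      · rw [← OnePoint.coe_injective hwz, ← spec_ofLinear_coe]
        exact hw
      · exact absurd h (OnePoint.coe_ne_infty z)

theorem exists_isSuitable (a : X →L[ℂ] X)
    (h0 : (0 : ℂ) ∈ isoPts (browderSpec (ofLinear (a : X →ₗ[ℂ] X)))) :
    ∃ s : Set ℂ, IsSuitable (ofLinear (a : X →ₗ[ℂ] X)) s := by
  obtain ⟨h0, hacc⟩ := h0
  have hev : ∀ᶠ z in 𝓝[≠] (0 : ℂ), z ∉ browderSpec (ofLinear (a : X →ₗ[ℂ] X)) := by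
    rw [accPt_iff_frequently_nhdsNE] at hacc
    exact not_frequently.1 hacc
  obtain ⟨ε, hε, hball⟩ := Metric.mem_nhdsWithin_iff.1 hev
  let F : Set ℂ := spectrum ℂ a ∩ (Metric.ball 0 ε \ {0})
  -- Each point of `F` lies outside the Browder spectrum, hence has a punctured neighbourhood free
  -- of spectrum.
  have hdisc : DiscreteTopology F := by
    rw [discreteTopology_subtype_iff]
    intro z hz
    have h1 := eventually_mem_resolventSet_of_notMem_browderSpec (hball hz.2)
    rw [← _root_.disjoint_iff, Filter.disjoint_principal_right]
    filter_upwards [h1] with w hw hwF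
    rw [mem_resolventSet_ofLinear_coe] at hw
    exact hwF.1 hw
  have hF : F.Countable := by
    rw [← Set.countable_coe_iff]
    exact countable_of_Lindelof_of_discrete
  -- The radius avoids the countably many moduli of points of `F`. It is below `ε` so that nonzero
  -- spectral points inside are Riesz points, and below `1/4` as suitability demands.
  obtain ⟨r, hr, hrF⟩ := ((hF.image norm).dense_compl ℝ).inter_open_nonempty
    (Set.Ioo 0 (min ε (1 / 4))) isOpen_Ioo
    (Set.nonempty_Ioo.2 (lt_min hε (by norm_num)))
  have hrε : r < ε := hr.2.trans_le (min_le_left _ _)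
  have hr4 : r < 1 / 4 := hr.2.trans_le (min_le_right _ _)
  have hsphere : ∀ z ∈ spectrum ℂ a, ‖z‖ ≠ r := by
    intro z hz hzr
    refine hrF ⟨z, ⟨hz, ?_, ?_⟩, hzr⟩
    · rw [mem_ball_zero_iff, hzr]
      exact hrε
    · rintro rfl
      exact hr.1.ne (by simpa using hzr)
  refine ⟨spectrum ℂ a ∩ Metric.ball 0 r, isBoundedSpectralSet_inter_ball a r hsphere,
    ⟨?_, Metric.mem_ball_self hr.1⟩, ?_, r, hr4, Set.inter_subset_right, ?_⟩
  · rw [← spec_ofLinear_coe]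
    exact browderSpec_subset_spec a h0
  · rintro z ⟨⟨hz, hzr⟩, hz0⟩
    exact ⟨by rwa [spec_ofLinear_coe], hball ⟨Metric.ball_subset_ball hrε.le hzr, hz0⟩⟩
  · rw [spec_ofLinear_coe]
    ext z
    simp only [Set.mem_inter_iff, Set.mem_sdiff, Set.mem_empty_iff_false, iff_false]
    tauto

end Isolated

/-! ### Circle integrals: bounded maps and interchange of order -/

section CircleIntegral

open MeasureTheory Metric

variable {F G : Type*} [NormedAddCommGroup F] [NormedSpace ℂ F]
  [NormedAddCommGroup G] [NormedSpace ℂ G]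

theorem _root_.ContinuousLinearMap.circleIntegral_comp_comm [CompleteSpace F] [CompleteSpace G]
    (L : F →L[ℂ] G) {f : ℂ → F}
    {c : ℂ} {r : ℝ} (hf : CircleIntegrable f c r) : ∮ z in C(c, r), L (f z) = L (∮ z in C(c, r), f z) := by
  simp only [circleIntegral, ← map_smul]
  exact L.intervalIntegral_comp_comm hf.out

theorem circleIntegral_swap {f : ℂ → ℂ → F} {r s : ℝ} (hr : 0 ≤ r) (hs : 0 ≤ s)
    (hf : ContinuousOn (Function.uncurry f) (sphere 0 r ×ˢ sphere 0 s)) :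
    ∮ w in C(0, r), ∮ z in C(0, s), f w z = ∮ z in C(0, s), ∮ w in C(0, r), f w z := by
  have hc : Continuous fun x : ℝ × ℝ => deriv (circleMap 0 r) x.1 • deriv (circleMap 0 s) x.2 •
      f (circleMap 0 r x.1) (circleMap 0 s x.2) := by
    simp only [deriv_circleMap]
    have h1 : Continuous fun x : ℝ × ℝ => f (circleMap 0 r x.1) (circleMap 0 s x.2) :=
      hf.comp_continuous (f := fun x : ℝ × ℝ => (circleMap 0 r x.1, circleMap 0 s x.2))
        (by fun_prop) fun x => ⟨circleMap_mem_sphere 0 hr _, circleMap_mem_sphere 0 hs _⟩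
    exact (by fun_prop : Continuous fun x : ℝ × ℝ => circleMap 0 r x.1 * Complex.I).smul
      ((by fun_prop : Continuous fun x : ℝ × ℝ => circleMap 0 s x.2 * Complex.I).smul h1)
  have h := intervalIntegral_intervalIntegral_swap (a := 0) (b := 2 * Real.pi) (c := 0)
    (d := 2 * Real.pi)
    (F := fun x y => deriv (circleMap 0 r) x • deriv (circleMap 0 s) y •
      f (circleMap 0 r x) (circleMap 0 s y))
    ((hc.continuousOn.integrableOn_compact (isCompact_uIcc.prod isCompact_uIcc)).mono_set
      (Set.prod_mono Set.uIoc_subset_uIcc Set.uIoc_subset_uIcc))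
  simp only [circleIntegral, ← intervalIntegral.integral_smul]
  rw [h]
  simp only [smul_comm (deriv (circleMap 0 r) _) (deriv (circleMap 0 s) _)]

end CircleIntegral

/-! ### The Riesz integral of the resolvent over circles about the origin -/

section RieszProjection

open Metric

variable {𝒜 : Type*} [NormedRing 𝒜] [NormedAlgebra ℂ 𝒜]

theorem _root_.Commute.ringInverse_right_of_isUnit {R : Type*} [Ring R] {c u : R}
    (h : Commute c u) (hu : IsUnit u) : Commute c (Ring.inverse u) := by
  rw [← hu.unit_spec, Ring.inverse_unit]
  exact Commute.units_inv_right (by rwa [hu.unit_spec])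

theorem sub_mul_resolvent {a : 𝒜} {z : ℂ} (hz : z ∈ _root_.resolventSet ℂ a) :
    (algebraMap ℂ 𝒜 z - a) * resolvent a z = 1 :=
  Ring.mul_inverse_cancel _ hz

variable [CompleteSpace 𝒜]

theorem continuousOn_resolvent {a : 𝒜} {s : Set ℂ} (hs : s ⊆ _root_.resolventSet ℂ a) :
    ContinuousOn (resolvent a) s := fun _ hz =>
  (spectrum.hasDerivAt_resolvent_const_left (hs hz)).continuousAt.continuousWithinAt

/-- The integral `(2πi)⁻¹ ∮ g(z) (z - a)⁻¹ dz` over the circle `|z| = r`. -/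
noncomputable def resolventIntegral (a : 𝒜) (r : ℝ) (g : ℂ → ℂ) : 𝒜 :=
  (2 * Real.pi * Complex.I : ℂ)⁻¹ • ∮ z in C(0, r), g z • resolvent a z

variable {a : 𝒜} {r : ℝ}

theorem circleIntegrable_smul_resolvent (hr : 0 ≤ r) (ha : sphere 0 r ⊆ _root_.resolventSet ℂ a)
    {g : ℂ → ℂ} (hg : ContinuousOn g (sphere 0 r)) :
    CircleIntegrable (fun z => g z • resolvent a z) 0 r :=
  (hg.smul (continuousOn_resolvent ha)).circleIntegrable hr

theorem commute_resolventIntegral (hr : 0 ≤ r) (ha : sphere 0 r ⊆ _root_.resolventSet ℂ a)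
    {g : ℂ → ℂ} (hg : ContinuousOn g (sphere 0 r)) {c : 𝒜} (hc : Commute c a) :
    Commute c (resolventIntegral a r g) := by
  have hi := circleIntegrable_smul_resolvent hr ha hg
  have h1 := (ContinuousLinearMap.mul ℂ 𝒜 c).circleIntegral_comp_comm hi
  have h2 := ((ContinuousLinearMap.mul ℂ 𝒜).flip c).circleIntegral_comp_comm hi
  simp only [ContinuousLinearMap.mul_apply', ContinuousLinearMap.flip_apply] at h1 h2
  refine Commute.smul_right ?_ _
  change _ * _ = _ * _
  rw [← h1, ← h2]
  refine circleIntegral.integral_congr hr fun z hz => ?_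
  have hcz : Commute c (resolvent a z) := by
    have : Commute c (algebraMap ℂ 𝒜 z - a) :=
      (Algebra.commute_algebraMap_right z c).sub_right hc
    exact this.ringInverse_right_of_isUnit (ha hz)
  exact hcz.smul_right (g z)

/-- `(w - a) ∮ g(z) (z - a)⁻¹ dz = ∮ (w - z) g(z) (z - a)⁻¹ dz + ∮ g(z) dz`. -/
theorem sub_mul_resolventIntegral (hr : 0 ≤ r) (ha : sphere 0 r ⊆ _root_.resolventSet ℂ a)
    {g : ℂ → ℂ} (hg : ContinuousOn g (sphere 0 r)) (w : ℂ) :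
    (algebraMap ℂ 𝒜 w - a) * resolventIntegral a r g =
      resolventIntegral a r (fun z => (w - z) * g z) +
        algebraMap ℂ 𝒜 ((2 * Real.pi * Complex.I : ℂ)⁻¹ * ∮ z in C(0, r), g z) := by
  have hi := circleIntegrable_smul_resolvent hr ha hg
  have h1 := (ContinuousLinearMap.mul ℂ 𝒜 (algebraMap ℂ 𝒜 w - a)).circleIntegral_comp_comm hi
  simp only [ContinuousLinearMap.mul_apply'] at h1
  rw [resolventIntegral, mul_smul_comm, ← h1, resolventIntegral,
    Algebra.algebraMap_eq_smul_one (_ * _), mul_smul, ← smul_add, ← circleIntegral.integral_smul_const,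
    ← circleIntegral.integral_add
      (circleIntegrable_smul_resolvent hr ha (g := fun z => (w - z) * g z) (by fun_prop))
      (ContinuousOn.circleIntegrable hr (f := fun z => g z • (1 : 𝒜)) (by fun_prop))]
  congr 1
  refine circleIntegral.integral_congr hr fun z hz => ?_
  have hz' := sub_mul_resolvent (ha hz)
  -- The summand `z - a` cancels the resolvent and leaves the scalar integral of `g`.
  have h2 : algebraMap ℂ 𝒜 w - a = (w - z) • 1 + (algebraMap ℂ 𝒜 z - a) := by
    rw [sub_smul, ← Algebra.algebraMap_eq_smul_one, ← Algebra.algebraMap_eq_smul_one]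
    abel
  rw [mul_smul_comm, h2, add_mul, hz', smul_one_mul, smul_add, smul_smul, mul_comm (g z)]

variable {r₁ r₂ : ℝ}

/-- Cauchy's theorem on an annulus where the resolvent is holomorphic. -/
theorem resolventIntegral_const_eq (h1 : 0 < r₁) (h12 : r₁ ≤ r₂)
    (ha : closedBall 0 r₂ \ ball 0 r₁ ⊆ _root_.resolventSet ℂ a) :
    resolventIntegral a r₂ (fun _ => 1) = resolventIntegral a r₁ fun _ => 1 := by
  simp only [resolventIntegral, one_smul]
  congr 1
  refine Complex.circleIntegral_eq_of_differentiable_on_annulus_off_countable h1 h12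
    Set.countable_empty (continuousOn_resolvent ha) fun z hz => ?_
  refine (spectrum.hasDerivAt_resolvent_const_left (ha ⟨ball_subset_closedBall hz.1.1, ?_⟩)
    ).differentiableAt
  exact fun h => hz.1.2 (ball_subset_closedBall h)

theorem sphere_subset_annulus_left (h12 : r₁ ≤ r₂) :
    sphere (0 : ℂ) r₁ ⊆ closedBall 0 r₂ \ ball 0 r₁ := by
  intro z hz
  simp only [mem_sphere_zero_iff_norm] at hz
  simp [hz, h12]

theorem sphere_subset_annulus_right (h12 : r₁ ≤ r₂) :
    sphere (0 : ℂ) r₂ ⊆ closedBall 0 r₂ \ ball 0 r₁ := by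
  intro z hz
  simp only [mem_sphere_zero_iff_norm] at hz
  simp [hz, h12]

/-- For `w` outside the circle the scalar integral of `(w - z)⁻¹` vanishes. This supplies the
inverse of `w - a` on the range of the projection. -/
theorem sub_mul_resolventIntegral_inv_sub (h1 : 0 ≤ r₁)
    (ha : sphere 0 r₁ ⊆ _root_.resolventSet ℂ a) {w : ℂ} (hw : r₁ < ‖w‖) :
    (algebraMap ℂ 𝒜 w - a) * resolventIntegral a r₁ (fun z => (w - z)⁻¹) =
      resolventIntegral a r₁ fun _ => 1 := by
  have hne : ∀ z ∈ closedBall (0 : ℂ) r₁, w - z ≠ 0 := by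
    intro z hz h
    rw [sub_eq_zero] at h
    rw [← h, mem_closedBall_zero_iff] at hz
    exact hw.not_ge hz
  have hd : DifferentiableOn ℂ (fun z => (w - z)⁻¹) (closedBall (0 : ℂ) r₁) := fun z hz =>
    (((differentiableAt_const w).sub differentiableAt_id).inv (hne z hz)).differentiableWithinAt
  rw [sub_mul_resolventIntegral h1 ha (hd.continuousOn.mono sphere_subset_closedBall),
    Complex.circleIntegral_eq_zero_of_differentiable_on_off_countable h1 Set.countable_empty
      hd.continuousOn, mul_zero, map_zero, add_zero]
  · simp only [resolventIntegral]
    congr 1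
    refine circleIntegral.integral_congr h1 fun z hz => ?_
    rw [mul_inv_cancel₀ (hne z (sphere_subset_closedBall hz))]
  · intro z hz
    exact (((differentiableAt_const w).sub differentiableAt_id).inv
      (hne z (ball_subset_closedBall hz.1)))

/-- For `w` inside the circle the scalar integral of `(z - w)⁻¹` is `2πi`, which produces the `1`.
This supplies the inverse of `w - a` on the null space of the projection. -/
theorem sub_mul_resolventIntegral_sub_inv (h2 : 0 ≤ r₂)
    (ha : sphere 0 r₂ ⊆ _root_.resolventSet ℂ a) {w : ℂ} (hw : ‖w‖ < r₂) :
    (algebraMap ℂ 𝒜 w - a) * resolventIntegral a r₂ (fun z => (z - w)⁻¹) =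
      1 - resolventIntegral a r₂ fun _ => 1 := by
  have hne : ∀ z ∈ sphere (0 : ℂ) r₂, z - w ≠ 0 := by
    intro z hz h
    rw [sub_eq_zero] at h
    rw [h, mem_sphere_zero_iff_norm] at hz
    exact hw.ne hz
  have hc : ContinuousOn (fun z => (z - w)⁻¹) (sphere (0 : ℂ) r₂) :=
    (continuousOn_id.sub continuousOn_const).inv₀ hne
  rw [sub_mul_resolventIntegral h2 ha hc,
    circleIntegral.integral_sub_inv_of_mem_ball (by simpa using hw),
    inv_mul_cancel₀ Complex.two_pi_I_ne_zero, map_one, add_comm, sub_eq_add_neg]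
  congr 1
  simp only [resolventIntegral]
  rw [← smul_neg]
  congr 1
  have : ∀ f : ℂ → 𝒜, -(∮ z in C(0, r₂), f z) = ∮ z in C(0, r₂), (-1 : ℂ) • f z := by
    intro f
    rw [circleIntegral.integral_smul, neg_one_smul]
  rw [this]
  refine circleIntegral.integral_congr h2 fun z hz => ?_
  rw [smul_smul]
  congr 1
  have := hne z hz
  field_simp
  ring

/-- Take one factor over each circle. For `w` on the outer circle, `P` times the resolvent at `w` is
the inner integral with kernel `(w - z)⁻¹`. After interchanging the integrals, the outer one is the
scalar `2πi`, because `z` lies inside. -/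
theorem isIdempotentElem_resolventIntegral (h1 : 0 < r₁) (h12 : r₁ < r₂)
    (ha : closedBall 0 r₂ \ ball 0 r₁ ⊆ _root_.resolventSet ℂ a) :
    IsIdempotentElem (resolventIntegral a r₁ fun _ => 1) := by
  have h2 : 0 < r₂ := h1.trans h12
  have hs1 := (sphere_subset_annulus_left h12.le).trans ha
  have hs2 := (sphere_subset_annulus_right h12.le).trans ha
  set P := resolventIntegral a r₁ fun _ => 1 with hP
  have hPR : ∀ w ∈ sphere (0 : ℂ) r₂,
      P * ((1 : ℂ) • resolvent a w) = resolventIntegral a r₁ (fun z => (w - z)⁻¹) := by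
    intro w hw
    have hw' : r₁ < ‖w‖ := by rw [mem_sphere_zero_iff_norm.1 hw]; exact h12
    have hc : ContinuousOn (fun z => (w - z)⁻¹) (sphere (0 : ℂ) r₁) := by
      refine (continuousOn_const.sub continuousOn_id).inv₀ fun z hz h => ?_
      have h : w = z := sub_eq_zero.1 h
      rw [h, mem_sphere_zero_iff_norm.1 hz] at hw'
      exact lt_irrefl _ hw'
    have hcomm : Commute (algebraMap ℂ 𝒜 w - a) (resolventIntegral a r₁ (fun z => (w - z)⁻¹)) :=
      commute_resolventIntegral h1.le hs1 hc
        ((Algebra.commute_algebraMap_left w a).sub_left (Commute.refl a))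
    rw [one_smul, hP, ← sub_mul_resolventIntegral_inv_sub h1.le hs1 hw', hcomm.eq, mul_assoc,
      sub_mul_resolvent (hs2 hw), mul_one]
  have hi := circleIntegrable_smul_resolvent h2.le hs2 (g := fun _ => 1) continuousOn_const
  have h3 := (ContinuousLinearMap.mul ℂ 𝒜 P).circleIntegral_comp_comm hi
  simp only [ContinuousLinearMap.mul_apply'] at h3
  change P * P = P
  have hP' : P = resolventIntegral a r₂ fun _ => 1 :=
    (resolventIntegral_const_eq h1 h12.le ha).symm
  nth_rewrite 2 [hP']
  rw [resolventIntegral, mul_smul_comm, ← h3, circleIntegral.integral_congr h2.le hPR]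
  simp only [resolventIntegral]
  rw [circleIntegral.integral_smul, circleIntegral_swap h2.le h1.le, smul_smul]
  · have h4 : ∀ z ∈ sphere (0 : ℂ) r₁, (∮ w in C(0, r₂), (w - z)⁻¹ • resolvent a z) =
        (2 * Real.pi * Complex.I : ℂ) • (1 : ℂ) • resolvent a z := by
      intro z hz
      rw [circleIntegral.integral_smul_const, circleIntegral.integral_sub_inv_of_mem_ball,
        one_smul]
      rw [mem_ball_zero_iff, mem_sphere_zero_iff_norm.1 hz]
      exact h12
    rw [circleIntegral.integral_congr h1.le h4, circleIntegral.integral_smul, smul_smul, mul_assoc,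
      inv_mul_cancel₀ Complex.two_pi_I_ne_zero, mul_one]
    rfl
  · refine ContinuousOn.smul ?_ ?_
    · refine (continuousOn_fst.sub continuousOn_snd).inv₀ ?_
      rintro ⟨w, z⟩ ⟨hw, hz⟩ h
      have h : w = z := sub_eq_zero.1 h
      rw [mem_sphere_zero_iff_norm] at hw hz
      rw [h] at hw
      exact h12.ne (hz.symm.trans hw)
    · exact (continuousOn_resolvent hs1).comp continuousOn_snd fun x hx => hx.2

end RieszProjection

section BoundedOperators

variable {X : Type*} [NormedAddCommGroup X] [NormedSpace ℂ X]

/-! ### Spectral projections of suitable sets -/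

section SpectralProjection

open Metric

/-- `H` inverts `w - a` modulo `P` but is not assumed to map into the null space of `P`. The factor
`1 - P` in `(1 - P) * H` forces the solution into it. -/
theorem mem_resolventSet_part_ker {a P H : X →L[ℂ] X} {w : ℂ} (hP : IsIdempotentElem P)
    (hPa : Commute P a) (hHa : Commute H a)
    (hw : (algebraMap ℂ (X →L[ℂ] X) w - a) * H = 1 - P)
    (h : ∀ x : (ofLinear (a : X →ₗ[ℂ] X)).domain, (x : X) ∈ LinearMap.ker (P : X →ₗ[ℂ] X) →
      ofLinear (a : X →ₗ[ℂ] X) x ∈ LinearMap.ker (P : X →ₗ[ℂ] X)) :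
    w ∈ resolventSet (part (ofLinear (a : X →ₗ[ℂ] X)) _ h) := by
  have hc : ∀ c : X →L[ℂ] X, Commute c a → Commute c (algebraMap ℂ (X →L[ℂ] X) w - a) :=
    fun c hc => (Algebra.commute_algebraMap_right w c).sub_right hc
  have e1 : H * (algebraMap ℂ (X →L[ℂ] X) w - a) = 1 - P := by rw [(hc H hHa).eq, hw]
  have e2 : (algebraMap ℂ (X →L[ℂ] X) w - a) * ((1 - P) * H) = 1 - P := by
    rw [← mul_assoc, ← (hc _ ((Commute.one_left a).sub_left hPa)).eq, mul_assoc, hw,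
      hP.one_sub.eq]
  have e3 : P * ((1 - P) * H) = 0 := by
    rw [← mul_assoc, mul_sub, mul_one, hP.eq, sub_self, zero_mul]
  rw [mem_resolventSet_part_ofLinear]
  refine ⟨fun x hx h0 => ?_, fun y hy => ⟨((1 - P) * H) y, ?_, ?_⟩⟩
  · have h1 : (H * (algebraMap ℂ (X →L[ℂ] X) w - a)) x = H (w • x - a x) := rfl
    have h2 : (1 - P) x = x - P x := rfl
    have h3 : P x = 0 := hx
    have h4 : w • x - a x = 0 := h0
    rw [e1, h2, h3, h4, map_zero, sub_zero] at h1
    exact h1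
  · exact congrArg (fun f : X →L[ℂ] X => f y) e3
  · have h1 := congrArg (fun f : X →L[ℂ] X => f y) e2
    have h2 : (1 - P) y = y - P y := rfl
    have h3 : P y = 0 := hy
    simp only [h2, h3, sub_zero] at h1
    exact h1

theorem mem_resolventSet_part_range {a P H : X →L[ℂ] X} {w : ℂ} (hP : IsIdempotentElem P)
    (hPa : Commute P a) (hHa : Commute H a)
    (hw : (algebraMap ℂ (X →L[ℂ] X) w - a) * H = P)
    (h : ∀ x : (ofLinear (a : X →ₗ[ℂ] X)).domain, (x : X) ∈ LinearMap.range (P : X →ₗ[ℂ] X) →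
      ofLinear (a : X →ₗ[ℂ] X) x ∈ LinearMap.range (P : X →ₗ[ℂ] X)) :
    w ∈ resolventSet (part (ofLinear (a : X →ₗ[ℂ] X)) _ h) := by
  have hc : ∀ c : X →L[ℂ] X, Commute c a → Commute c (algebraMap ℂ (X →L[ℂ] X) w - a) :=
    fun c hc => (Algebra.commute_algebraMap_right w c).sub_right hc
  have e1 : H * (algebraMap ℂ (X →L[ℂ] X) w - a) = P := by rw [(hc H hHa).eq, hw]
  have e2 : (algebraMap ℂ (X →L[ℂ] X) w - a) * (P * H) = P := by
    rw [← mul_assoc, ← (hc _ hPa).eq, mul_assoc, hw, hP.eq]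
  have hfix : ∀ x ∈ LinearMap.range (P : X →ₗ[ℂ] X), P x = x := by
    rintro _ ⟨x, rfl⟩
    exact congrArg (fun f : X →L[ℂ] X => f x) hP.eq
  rw [mem_resolventSet_part_ofLinear]
  refine ⟨fun x hx h0 => ?_, fun y hy => ⟨(P * H) y, ⟨H y, rfl⟩, ?_⟩⟩
  · have h1 : (H * (algebraMap ℂ (X →L[ℂ] X) w - a)) x = H (w • x - a x) := rfl
    have h4 : w • x - a x = 0 := h0
    rw [e1, hfix x hx, h4, map_zero] at h1
    exact h1
  · have h1 := congrArg (fun f : X →L[ℂ] X => f y) e2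
    simp only [hfix y hy] at h1
    exact h1

variable [CompleteSpace X]

/-- The Riesz projection of the part of the spectrum inside a circle around the origin. -/
theorem exists_isSpectralProjection (a : X →L[ℂ] X) {r₁ r₂ : ℝ} (h1 : 0 < r₁) (h12 : r₁ < r₂)
    (ha : closedBall 0 r₂ \ ball 0 r₁ ⊆ _root_.resolventSet ℂ a) :
    ∃ P : X →L[ℂ] X, IsSpectralProjection (ofLinear (a : X →ₗ[ℂ] X))
      (spectrum ℂ a ∩ ball 0 r₂) P := by
  have h2 : 0 < r₂ := h1.trans h12
  have hs1 := (sphere_subset_annulus_left h12.le).trans ha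
  have hs2 := (sphere_subset_annulus_right h12.le).trans ha
  let P : X →L[ℂ] X := resolventIntegral a r₁ fun _ => 1
  have hP : IsIdempotentElem P := isIdempotentElem_resolventIntegral h1 h12 ha
  have hPa : Commute P a :=
    (commute_resolventIntegral h1.le hs1 continuousOn_const (Commute.refl a)).symm
  have hPa' : ∀ x, P (a x) = a (P x) := fun x => congrArg (fun f : X →L[ℂ] X => f x) hPa.eq
  have hred : IsReduction (ofLinear (a : X →ₗ[ℂ] X)) (LinearMap.ker (P : X →ₗ[ℂ] X))
      (LinearMap.range (P : X →ₗ[ℂ] X)) := by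
    refine ⟨P.isClosed_ker, ContinuousLinearMap.IsIdempotentElem.isClosed_range hP, ?_,
      fun _ _ => trivial, ?_,
      (LinearMap.IsIdempotentElem.isCompl
        (ContinuousLinearMap.IsIdempotentElem.toLinearMap hP)).symm⟩
    · intro x hx
      have hx' : P x = 0 := hx
      change P (a x) = 0
      rw [hPa', hx', map_zero]
    · rintro x ⟨y, hy⟩
      exact ⟨a y, (hPa' y).trans (congrArg a hy)⟩
  have hN : ∀ w : ℂ, r₁ < ‖w‖ →
      w ∈ resolventSet (part (ofLinear (a : X →ₗ[ℂ] X)) _ hred.map_right) := by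
    intro w hw
    refine mem_resolventSet_part_range hP hPa
      (commute_resolventIntegral h1.le hs1 ?_ (Commute.refl a)).symm
      (sub_mul_resolventIntegral_inv_sub h1.le hs1 hw) _
    refine ContinuousOn.inv₀ (by fun_prop) fun z hz h => ?_
    rw [sub_eq_zero] at h
    rw [h, mem_sphere_zero_iff_norm.1 hz] at hw
    exact lt_irrefl _ hw
  have hM : ∀ w : ℂ, ‖w‖ < r₂ →
      w ∈ resolventSet (part (ofLinear (a : X →ₗ[ℂ] X)) _ hred.map_left) := by
    intro w hw
    refine mem_resolventSet_part_ker hP hPa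
      (commute_resolventIntegral h2.le hs2 ?_ (Commute.refl a)).symm
      ((sub_mul_resolventIntegral_sub_inv h2.le hs2 hw).trans
        (congrArg (1 - ·) (resolventIntegral_const_eq h1 h12.le ha))) _
    refine ContinuousOn.inv₀ (by fun_prop) fun z hz h => ?_
    rw [sub_eq_zero] at h
    rw [← h, mem_sphere_zero_iff_norm.1 hz] at hw
    exact lt_irrefl _ hw
  -- By `hN` and `hM` the parts in the range and in the null space have spectra in `‖w‖ ≤ r₁` and
  -- `‖w‖ ≥ r₂`. Their union is the spectrum of `a`, so both can be read off.
  have hdec := fun w => mem_resolventSet_iff_of_isCompl w (a : X →ₗ[ℂ] X) hred.isCompl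
    hred.map_left hred.map_right
  refine ⟨P, hP, hred, ?_, ?_⟩
  · ext w
    rw [← spec_ofLinear_coe]
    simp only [spec, Set.mem_compl_iff, Set.mem_sdiff, Set.mem_inter_iff, mem_ball_zero_iff, hdec]
    constructor
    · intro h
      exact ⟨fun h' => h h'.1, fun h' => h (hM w h'.2)⟩
    · rintro ⟨h, h'⟩ h''
      have hr : r₂ ≤ ‖w‖ := not_lt.1 fun hlt => h' ⟨h, hlt⟩
      exact h ⟨h'', hN w (h12.trans_le hr)⟩
  · ext w
    rw [← spec_ofLinear_coe]
    simp only [spec, Set.mem_compl_iff, Set.mem_inter_iff, mem_ball_zero_iff, hdec]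
    constructor
    · intro h
      exact ⟨fun h' => h h'.2, (not_lt.1 fun hlt => h (hN w hlt)).trans_lt h12⟩
    · rintro ⟨h, h'⟩ h''
      exact h ⟨hM w h', h''⟩

/-- A relatively closed subset of the compactified spectrum pulls back to a relatively closed subset
of the closed set `spectrum ℂ a`. -/
theorem IsBoundedSpectralSet.isCompact {a : X →L[ℂ] X} {s : Set ℂ}
    (hs : IsBoundedSpectralSet (ofLinear (a : X →ₗ[ℂ] X)) s) : IsCompact s := by
  obtain ⟨hb, hsub, hcl, -⟩ := hs
  refine isCompact_of_isClosed_isBounded ?_ hb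
  obtain ⟨t, ht, hts⟩ := isClosed_induced_iff.1 hcl
  have hspec : s ⊆ spectrum ℂ a := by
    intro z hz
    rcases hsub ⟨z, hz, rfl⟩ with ⟨w, hw, hwz⟩ | h
    · rw [← OnePoint.coe_injective hwz, ← spec_ofLinear_coe]
      exact hw
    · exact absurd h (OnePoint.coe_ne_infty z)
  have hst : s = spectrum ℂ a ∩ ((↑) : ℂ → OnePoint ℂ) ⁻¹' t := by
    have hmem : ∀ z ∈ spectrum ℂ a, (z ∈ s ↔ (z : OnePoint ℂ) ∈ t) := by
      intro z hz
      have hz' : (z : OnePoint ℂ) ∈ specInfty (ofLinear (a : X →ₗ[ℂ] X)) :=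
        Or.inl ⟨z, by rwa [spec_ofLinear_coe], rfl⟩
      have h := Set.ext_iff.1 hts ⟨z, hz'⟩
      simp only [Set.mem_preimage] at h
      rw [h]
      exact (OnePoint.coe_injective.mem_set_image).symm
    ext z
    exact ⟨fun h => ⟨hspec h, (hmem z (hspec h)).1 h⟩, fun h => (hmem z h.1).2 h.2⟩
  rw [hst]
  exact (spectrum.isClosed a).inter (ht.preimage OnePoint.continuous_coe)

/-- By compactness the largest modulus in `s` is below the radius of the separating disc. Two radii
chosen in that gap bound an annulus free of spectrum, and `s` is the spectrum inside the larger one.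
-/
theorem IsSuitable.exists_isSpectralProjection {a : X →L[ℂ] X} {s : Set ℂ}
    (hs : IsSuitable (ofLinear (a : X →ₗ[ℂ] X)) s) :
    ∃ P : X →L[ℂ] X, IsSpectralProjection (ofLinear (a : X →ₗ[ℂ] X)) s P := by
  have hcomp := hs.isBoundedSpectralSet.isCompact
  obtain ⟨r, -, hsr, hdisj⟩ := hs.disc
  obtain ⟨m, hm, hmax⟩ := hcomp.exists_isMaxOn ⟨0, hs.zero_mem⟩ continuous_norm.continuousOn
  have hmr : ‖m‖ < r := by simpa using hsr hm
  obtain ⟨r₁, hr₁, hr₁'⟩ := exists_between hmr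
  obtain ⟨r₂, hr₂, hr₂'⟩ := exists_between hr₁'
  have h1 : 0 < r₁ := (norm_nonneg m).trans_lt hr₁
  rw [spec_ofLinear_coe] at hdisj
  have hmem : ∀ z ∈ spectrum ℂ a, ‖z‖ < r → z ∈ s := by
    intro z hz hzr
    by_contra hzs
    have hz0 : z ≠ 0 := by
      rintro rfl
      exact hzs hs.zero_mem
    have : z ∈ (ball 0 r \ {0}) ∩ (spectrum ℂ a \ s) := ⟨⟨by simpa using hzr, hz0⟩, hz, hzs⟩
    rw [hdisj] at this
    exact this
  have hsub : s ⊆ spectrum ℂ a := by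
    intro z hz
    by_cases hz0 : z = 0
    · rcases hs.isBoundedSpectralSet.2.1 ⟨z, hz, rfl⟩ with ⟨w, hw, hwz⟩ | h
      · rw [← OnePoint.coe_injective hwz, ← spec_ofLinear_coe]
        exact hw
      · exact absurd h (OnePoint.coe_ne_infty z)
    · rw [← spec_ofLinear_coe]
      exact (hs.riesz ⟨hz, hz0⟩).1
  have hseq : s = spectrum ℂ a ∩ ball 0 r₂ := by
    ext z
    rw [Set.mem_inter_iff, mem_ball_zero_iff]
    exact ⟨fun h => ⟨hsub h, ((hmax h).trans_lt hr₁).trans hr₂⟩,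
      fun h => hmem z h.1 (h.2.trans hr₂')⟩
  rw [hseq]
  refine ClosedOp.exists_isSpectralProjection a h1 hr₂ fun z hz => ?_
  rw [Set.mem_sdiff, mem_closedBall_zero_iff, mem_ball_zero_iff, not_lt] at hz
  by_contra hzs
  exact absurd (hmax (hmem z hzs (hz.1.trans_lt hr₂'))) (not_le.2 (hr₁.trans_le hz.2))

end SpectralProjection

/-! ### The essential spectrum is nonempty -/

section EssentialSpectrum

theorem exists_continuousLinearMap_eq_zero_iff.{u} {V : Type u} [NormedAddCommGroup V]
    [NormedSpace ℂ V] (I : Submodule ℂ V) (hI : IsClosed (I : Set V)) :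
    ∃ (Q : Type u) (_ : NormedAddCommGroup Q) (_ : NormedSpace ℂ Q) (π : V →L[ℂ] Q),
      ∀ u, π u = 0 ↔ u ∈ I :=
  ⟨V ⧸ I, inferInstance, inferInstance, I.mkQL, fun _ => Submodule.Quotient.mk_eq_zero I⟩

/-- Uniqueness of inverses modulo the compact operators: a left and a right one agree. -/
theorem isCompactOperator_sub_of_one_sub_mul {L b R : X →L[ℂ] X}
    (hL : IsCompactOperator (1 - L * b : X →L[ℂ] X))
    (hR : IsCompactOperator (1 - b * R : X →L[ℂ] X)) :
    L - R ∈ compactOperator (RingHom.id ℂ) X X := by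
  have h : L - R = L * (1 - b * R) - (1 - L * b) * R := by noncomm_ring
  rw [h]
  exact Submodule.sub_mem _ (hR.clm_comp L) (hL.comp_clm R)

variable [CompleteSpace X]

/-- An operator with finite-dimensional null space and range of finite codimension is invertible
modulo the compact operators. -/
theorem exists_isCompactOperator_one_sub_mul (b : X →L[ℂ] X)
    [FiniteDimensional ℂ (LinearMap.ker (b : X →ₗ[ℂ] X))]
    [FiniteDimensional ℂ (X ⧸ LinearMap.range (b : X →ₗ[ℂ] X))] :
    ∃ S : X →L[ℂ] X, IsCompactOperator (1 - S * b : X →L[ℂ] X) ∧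
      IsCompactOperator (1 - b * S : X →L[ℂ] X) := by
  obtain ⟨p, hp⟩ := Submodule.ClosedComplemented.of_finiteDimensional
    (LinearMap.ker (b : X →ₗ[ℂ] X))
  obtain ⟨Z, hZ⟩ := Submodule.exists_isCompl (LinearMap.range (b : X →ₗ[ℂ] X))
  have : FiniteDimensional ℂ Z :=
    LinearEquiv.finiteDimensional (Submodule.quotientEquivOfIsCompl _ Z hZ)
  let Y : Submodule ℂ X := LinearMap.ker p.toLinearMap
  have hY : IsClosed (Y : Set X) := p.isClosed_ker
  have : CompleteSpace Y := hY.completeSpace_coe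
  have hbp : ∀ x, b (p x : X) = 0 := fun x => (p x).2
  have hproj : ∀ x, x - (p x : X) ∈ Y := by
    intro x
    change p (x - (p x : X)) = 0
    rw [map_sub, hp, sub_self]
  -- `Y` complements the null space and `Z` the range, so `Φ` is an isomorphism. `S` is the
  -- `Y`-component of its inverse, and both defects are projections of finite rank.
  let Φ : (Y × Z) →L[ℂ] X := (b ∘L Y.subtypeL).coprod Z.subtypeL
  have hker : LinearMap.ker (Φ : (Y × Z) →ₗ[ℂ] X) = ⊥ := by
    rw [LinearMap.ker_eq_bot']
    rintro ⟨y, z⟩ h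
    have h' : b (y : X) + (z : X) = 0 := h
    have hz : (z : X) = 0 := by
      refine Submodule.disjoint_def.1 hZ.disjoint z ⟨-(y : X), ?_⟩ z.2
      rw [map_neg]
      exact neg_eq_of_add_eq_zero_right h'
    rw [hz, add_zero] at h'
    have hy : (y : X) = 0 := by
      have h1 := hp ⟨(y : X), h'⟩
      have h2 : p (y : X) = 0 := y.2
      have h3 : (⟨(y : X), h'⟩ : LinearMap.ker (b : X →ₗ[ℂ] X)) = 0 := h1.symm.trans h2
      exact congrArg Subtype.val h3
    exact Prod.ext (Subtype.ext hy) (Subtype.ext hz)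
  have hran : LinearMap.range (Φ : (Y × Z) →ₗ[ℂ] X) = ⊤ := by
    rw [LinearMap.range_eq_top]
    intro x
    obtain ⟨_, ⟨u, rfl⟩, z, hz, h⟩ := Submodule.mem_sup.1
      (hZ.sup_eq_top ▸ trivial : x ∈ LinearMap.range (b : X →ₗ[ℂ] X) ⊔ Z)
    refine ⟨(⟨u - (p u : X), hproj u⟩, ⟨z, hz⟩), ?_⟩
    change b (u - (p u : X)) + z = x
    rw [map_sub, hbp, sub_zero]
    exact h
  let e := ContinuousLinearEquiv.ofBijective Φ hker hran
  have heΦ : ∀ (y : Y) (z : Z), e.symm (b (y : X) + (z : X)) = (y, z) := fun y z =>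
    ContinuousLinearEquiv.ofBijective_symm_apply_apply Φ hker hran (y, z)
  let q : X →L[ℂ] Z := ContinuousLinearMap.snd ℂ Y Z ∘L (e.symm : X →L[ℂ] Y × Z)
  let S : X →L[ℂ] X := Y.subtypeL ∘L ContinuousLinearMap.fst ℂ Y Z ∘L (e.symm : X →L[ℂ] Y × Z)
  refine ⟨S, ?_, ?_⟩
  · have h : 1 - S * b = (LinearMap.ker (b : X →ₗ[ℂ] X)).subtypeL ∘L p := by
      ext x
      have h1 := heΦ ⟨x - (p x : X), hproj x⟩ 0
      simp only [map_sub, hbp, sub_zero, ZeroMemClass.coe_zero, add_zero] at h1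
      change x - ((e.symm (b x)).1 : X) = (p x : X)
      rw [h1, sub_sub_cancel]
    have : ProperSpace (LinearMap.ker (b : X →ₗ[ℂ] X)) := FiniteDimensional.proper ℂ _
    have hpc : IsCompactOperator p := isCompactOperator_of_locallyCompactSpace_dom p
    rw [h]
    exact hpc.clm_comp (LinearMap.ker (b : X →ₗ[ℂ] X)).subtypeL
  · have h : 1 - b * S = Z.subtypeL ∘L q := by
      ext x
      have h1 : Φ (e.symm x) = x :=
        ContinuousLinearEquiv.ofBijective_apply_symm_apply Φ hker hran x
      have h2 : b ((e.symm x).1 : X) + ((e.symm x).2 : X) = x := h1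
      change x - b ((e.symm x).1 : X) = ((e.symm x).2 : X)
      rw [sub_eq_iff_eq_add', h2]
    have : ProperSpace Z := FiniteDimensional.proper ℂ _
    have hqc : IsCompactOperator q := isCompactOperator_of_locallyCompactSpace_dom q
    rw [h]
    exact hqc.clm_comp Z.subtypeL

/-- The essential spectrum of a bounded operator on an infinite-dimensional Banach space is not
empty. -/
theorem essSpec_ofLinear_coe_nonempty (hX : ¬ FiniteDimensional ℂ X) (a : X →L[ℂ] X) :
    (essSpec (ofLinear (a : X →ₗ[ℂ] X))).Nonempty := by
  by_contra hne
  rw [Set.not_nonempty_iff_eq_empty] at hne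
  have hF : ∀ z : ℂ, IsFredholm (ofLinear ((a - z • 1 : X →L[ℂ] X) : X →ₗ[ℂ] X)) := by
    intro z
    rw [← subLinear_ofLinear_smul]
    by_contra h
    have : z ∈ essSpec (ofLinear (a : X →ₗ[ℂ] X)) := h
    rw [hne] at this
    exact this
  have hS : ∀ z : ℂ, ∃ S : X →L[ℂ] X, IsCompactOperator (1 - S * (a - z • 1) : X →L[ℂ] X) ∧
      IsCompactOperator (1 - (a - z • 1) * S : X →L[ℂ] X) := by
    intro z
    obtain ⟨h1, h2⟩ := (isFredholm_ofLinear_coe_iff _).1 (hF z)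
    exact exists_isCompactOperator_one_sub_mul _
  choose S hS1 hS2 using hS
  -- Modulo compact operators `S z` is the inverse of `a - z`. Its class is an entire function
  -- vanishing at infinity, hence zero by Liouville, which makes `S 0`, and then the identity,
  -- compact.
  let I : Submodule ℂ (X →L[ℂ] X) := compactOperator (RingHom.id ℂ) X X
  have hI : IsClosed (I : Set (X →L[ℂ] X)) := isClosed_setOfPred_isCompactOperator
  obtain ⟨Q, _, _, π, hπ0⟩ := exists_continuousLinearMap_eq_zero_iff I hI
  have hπ : ∀ u v : X →L[ℂ] X, u - v ∈ I → π u = π v := fun u v h => by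
    rwa [← sub_eq_zero, ← map_sub, hπ0]
  let f : ℂ → Q := fun z => π (S z)
  have hdiff : Differentiable ℂ f := by
    intro z₀
    -- `(a - z) S z₀` equals `T z` up to a compact operator, so near `z₀` the holomorphic family `S
    -- z₀ (T z)⁻¹` is a right inverse modulo compacts and has the class of `S z`.
    let T : ℂ → (X →L[ℂ] X) := fun z => 1 - (z - z₀) • S z₀
    have hT : DifferentiableAt ℂ T z₀ := by fun_prop
    have hT0 : T z₀ = 1 := by simp [T]
    have hTu : IsUnit (T z₀) := hT0 ▸ isUnit_one
    have hev : ∀ᶠ z in 𝓝 z₀, IsUnit (T z) :=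
      hT.continuousAt.eventually (Units.isOpen.mem_nhds hTu)
    have hg : DifferentiableAt ℂ (fun z => π (S z₀ * Ring.inverse (T z))) z₀ := by
      have h1 : DifferentiableAt ℂ (fun z => Ring.inverse (T z)) z₀ :=
        (differentiableAt_inverse hTu).comp z₀ hT
      have h2 : DifferentiableAt ℂ (fun z => S z₀ * Ring.inverse (T z)) z₀ := h1.const_mul _
      exact π.differentiableAt.comp z₀ h2
    refine hg.congr_of_eventuallyEq ?_
    filter_upwards [hev] with z hz
    refine hπ _ _ (isCompactOperator_sub_of_one_sub_mul (hS1 z) ?_)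
    have h2 : (a - z • 1) * (S z₀ * Ring.inverse (T z)) =
        1 - (1 - (a - z₀ • 1) * S z₀) * Ring.inverse (T z) := by
      have h3 : (a - z • 1) * S z₀ = T z - (1 - (a - z₀ • 1) * S z₀) := by
        simp only [T, sub_mul, smul_mul_assoc, one_mul, sub_smul]
        abel
      rw [← mul_assoc, h3, sub_mul, Ring.mul_inverse_cancel _ hz]
    rw [h2, sub_sub_cancel]
    exact (hS2 z₀).comp_clm _
  -- For large `z` the class of `S z` is that of the genuine inverse of `a - z`, which is minus the
  -- resolvent.
  have hlim : Tendsto f (cocompact ℂ) (𝓝 0) := by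
    rw [← Metric.cobounded_eq_cocompact]
    have h1 : Tendsto (fun z => π (-resolvent a z)) (Bornology.cobounded ℂ) (𝓝 0) := by
      have := (π.continuous.tendsto (-0)).comp (spectrum.resolvent_tendsto_cobounded (𝕜 := ℂ) a).neg
      rw [neg_zero, map_zero] at this
      exact this
    refine h1.congr' ?_
    have hres : ∀ᶠ z in Bornology.cobounded ℂ, z ∈ _root_.resolventSet ℂ a := by
      filter_upwards [tendsto_norm_cobounded_atTop.eventually
        (eventually_gt_atTop (‖a‖ * ‖(1 : X →L[ℂ] X)‖))] with z hz
      exact spectrum.mem_resolventSet_of_norm_lt_mul hz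
    filter_upwards [hres] with z hz
    refine (hπ _ _ (isCompactOperator_sub_of_one_sub_mul (hS1 z) ?_)).symm
    have h2 := sub_mul_resolvent hz
    rw [Algebra.algebraMap_eq_smul_one] at h2
    have h3 : 1 - (a - z • 1) * -resolvent a z = 0 := by
      rw [mul_neg, ← neg_mul, neg_sub, h2, sub_self]
    rw [h3]
    exact isCompactOperator_zero
  have hzero : π (S 0) = 0 := hdiff.apply_eq_of_tendsto_cocompact 0 hlim
  have hS0 : S 0 ∈ I := (hπ0 _).1 hzero
  have hone : (1 : X →L[ℂ] X) ∈ I := by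
    have h1 : S 0 * (a - (0 : ℂ) • 1) ∈ I := IsCompactOperator.comp_clm hS0 _
    have h2 := I.add_mem (hS1 0) h1
    rwa [sub_add_cancel] at h2
  exact hX (FiniteDimensional.of_isCompactOperator_id hone)

end EssentialSpectrum

end BoundedOperators

/-! ### The Drazin inverse and the Laurent expansion -/

section DrazinInverse

section Laurent

open scoped ENNReal NNReal

variable {𝒜 : Type*} [NormedRing 𝒜] [NormedAlgebra ℂ 𝒜] [CompleteSpace 𝒜]

/-- The Neumann series converges inside the disc of radius the inverse of the spectral radius. -/
theorem hasSum_smul_pow_inverse_one_sub (c : 𝒜) {w : ℂ} (hw : ‖w‖ₑ < (spectralRadius ℂ c)⁻¹) :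
    HasSum (fun n : ℕ => w ^ n • c ^ n) (Ring.inverse (1 - w • c)) := by
  obtain ⟨r, hwr, hr⟩ := ENNReal.lt_iff_exists_nnreal_btwn.1 hw
  have hr0 : 0 < r := by
    have := pos_of_gt hwr
    exact_mod_cast this
  -- The function is holomorphic on the whole disc of radius `r`. Uniqueness of power series
  -- transfers this radius to the Neumann series, known at first only on a disc given by the norm.
  have h1 := (spectrum.differentiableOn_inverse_one_sub_smul hr).hasFPowerSeriesOnBall hr0
  have h2 := (spectrum.hasFPowerSeriesOnBall_inverse_one_sub_smul ℂ c).exchange_radius h1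
  have h3 := h2.hasSum (y := w) (by rwa [Metric.mem_eball, edist_zero_right])
  simpa [ContinuousMultilinearMap.mkPiRing_apply] using h3

/-- On the range of `P`, `(z - a)⁻¹` is a geometric series in `z⁻¹aP`, giving `(z - a)S = P`. On the
null space `B` inverts `a`, and a geometric series in `zB` gives `(z - a)T = -(1 - P)`. The two
bounds on `‖z‖` are the two convergence conditions. -/
theorem exists_laurent_hasSum {a P B : 𝒜} (hP : IsIdempotentElem P) (hPa : Commute P a)
    (haB : a * B = 1 - P) (hBa : Commute B a) (hBP : P * B = 0) {z : ℂ}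
    (hz : spectralRadius ℂ (a * P) < ‖z‖ₑ) (hz' : ‖z‖ₑ < (spectralRadius ℂ B)⁻¹) :
    ∃ S T : 𝒜, HasSum (fun p : ℕ => (z ^ (p + 1))⁻¹ • (a ^ p * P)) S ∧
      HasSum (fun p : ℕ => z ^ p • B ^ (p + 1)) T ∧
      (algebraMap ℂ 𝒜 z - a) * (S - T) = 1 ∧ (S - T) * (algebraMap ℂ 𝒜 z - a) = 1 := by
  have hz0 : z ≠ 0 := by
    rintro rfl
    simp at hz
  have hw : ‖z⁻¹‖ₑ < (spectralRadius ℂ (a * P))⁻¹ := by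
    rw [enorm_inv hz0]
    exact ENNReal.inv_lt_inv.2 hz
  have hU := hasSum_smul_pow_inverse_one_sub (a * P) hw
  have hV := hasSum_smul_pow_inverse_one_sub B hz'
  have hUu : IsUnit (1 - z⁻¹ • (a * P)) := spectrum.isUnit_one_sub_smul_of_lt_inv_radius hw
  have hVu : IsUnit (1 - z • B) := spectrum.isUnit_one_sub_smul_of_lt_inv_radius hz'
  set U := Ring.inverse (1 - z⁻¹ • (a * P)) with hUdef
  set V := Ring.inverse (1 - z • B) with hVdef
  have hUi : (1 - z⁻¹ • (a * P)) * U = 1 := Ring.mul_inverse_cancel _ hUu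
  have hVi : (1 - z • B) * V = 1 := Ring.mul_inverse_cancel _ hVu
  have haP : Commute a (a * P) := (Commute.refl a).mul_right hPa.symm
  have hPaP : Commute P (a * P) := hPa.mul_right (Commute.refl P)
  have haU : Commute a U :=
    ((Commute.one_right a).sub_right (haP.smul_right _)).ringInverse_right_of_isUnit hUu
  have hPU : Commute P U :=
    ((Commute.one_right P).sub_right (hPaP.smul_right _)).ringInverse_right_of_isUnit hUu
  have haV : Commute a V :=
    ((Commute.one_right a).sub_right (hBa.symm.smul_right _)).ringInverse_right_of_isUnit hVu
  have hBV : Commute B V :=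
    ((Commute.one_right B).sub_right ((Commute.refl B).smul_right _)).ringInverse_right_of_isUnit
      hVu
  -- The trailing `P` on the left is needed at `p = 0`, where `(aP)^0` is `1` and not `P`.
  have hpow : ∀ p : ℕ, (a * P) ^ p * P = a ^ p * P := by
    intro p
    induction p with
    | zero => simp
    | succ p ih =>
      rw [pow_succ', mul_assoc, ih, mul_assoc, ← mul_assoc P, (hPa.pow_right p).eq, mul_assoc,
        hP.eq, ← mul_assoc, pow_succ']
  let S : 𝒜 := z⁻¹ • (U * P)
  let T : 𝒜 := V * B
  have hSa : Commute a S := (haU.mul_right hPa.symm).smul_right _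
  have hTa : Commute a T := haV.mul_right hBa.symm
  have hS : (algebraMap ℂ 𝒜 z - a) * S = P := by
    have h1 : (algebraMap ℂ 𝒜 z - a) * S = (1 - z⁻¹ • a) * (P * U) := by
      rw [hPU.eq, Algebra.algebraMap_eq_smul_one]
      simp only [S, mul_smul_comm, sub_mul, smul_mul_assoc, one_mul, smul_sub, smul_smul,
        inv_mul_cancel₀ hz0, one_smul]
    have h2 : (1 - z⁻¹ • a) * P = P * (1 - z⁻¹ • (a * P)) := by
      rw [mul_sub, mul_one, mul_smul_comm, hPaP.eq, mul_assoc, hP.eq, sub_mul, one_mul,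
        smul_mul_assoc]
    rw [h1, ← mul_assoc, h2, mul_assoc, hUi, mul_one]
  have hT : (algebraMap ℂ 𝒜 z - a) * T = -(1 - P) := by
    have h1 : (algebraMap ℂ 𝒜 z - a) * T = (z • B - a * B) * V := by
      simp only [T, ← hBV.eq, Algebra.algebraMap_eq_smul_one, sub_mul, smul_mul_assoc, one_mul,
        mul_assoc]
    have h2 : z • B - a * B = -((1 - P) * (1 - z • B)) := by
      rw [haB, sub_mul, one_mul, mul_sub, mul_one, mul_smul_comm, hBP, smul_zero, sub_zero]
      abel
    rw [h1, h2, neg_mul, mul_assoc, hVi, mul_one]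
  have hST : (algebraMap ℂ 𝒜 z - a) * (S - T) = 1 := by
    rw [mul_sub, hS, hT]
    abel
  refine ⟨S, T, ?_, ?_, hST, ?_⟩
  · have hterm : (fun p : ℕ => (z ^ (p + 1))⁻¹ • (a ^ p * P)) =
        fun p : ℕ => z⁻¹ • ((z⁻¹ ^ p • (a * P) ^ p) * P) := by
      funext p
      rw [smul_mul_assoc, hpow, smul_smul, pow_succ', mul_inv, inv_pow]
    rw [hterm]
    exact (hU.mul_right P).const_smul z⁻¹
  · have hterm : (fun p : ℕ => z ^ p • B ^ (p + 1)) = fun p : ℕ => (z ^ p • B ^ p) * B := by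
      funext p
      rw [smul_mul_assoc, pow_succ]
    rw [hterm]
    exact hV.mul_right B
  · have hc : Commute (algebraMap ℂ 𝒜 z - a) (S - T) :=
      (Algebra.commute_algebraMap_left z _).sub_left (hSa.sub_right hTa)
    rw [← hc.eq, hST]

end Laurent

variable {X : Type*} [NormedAddCommGroup X] [NormedSpace ℂ X]

/-- Both the null space and the range of `P` are invariant under `a`, so `a` respects the splitting
`x = (x - Px) + Px`. -/
theorem IsSpectralProjection.commute {a P : X →L[ℂ] X} {s : Set ℂ}
    (hP : IsSpectralProjection (ofLinear (a : X →ₗ[ℂ] X)) s P) : Commute P a := by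
  obtain ⟨hid, h, -⟩ := hP
  ext x
  change P (a x) = a (P x)
  have hPP : ∀ y, P (P y) = P y := fun y => congrArg (fun f : X →L[ℂ] X => f y) hid.eq
  have h1 : P (a (x - P x)) = 0 := h.map_left ⟨x - P x, trivial⟩ (by
    change P (x - P x) = 0
    rw [map_sub, hPP, sub_self])
  obtain ⟨y, hy⟩ := h.map_right ⟨P x, trivial⟩ ⟨x, rfl⟩
  have hy' : P y = a (P x) := hy
  rw [map_sub, map_sub, sub_eq_zero] at h1
  rw [h1, ← hy', hPP]

theorem isBoundedInverse_ofLinear_coe_iff (b R : X →L[ℂ] X) :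
    IsBoundedInverse (ofLinear (b : X →ₗ[ℂ] X)) R ↔ b * R = 1 ∧ R * b = 1 := by
  constructor
  · rintro ⟨h1, h2⟩
    constructor
    · ext x
      exact (mem_graph_ofLinear (b : X →ₗ[ℂ] X) (R x) x).1 (h1 x)
    · ext x
      exact h2 ⟨x, trivial⟩
  · rintro ⟨h1, h2⟩
    refine ⟨fun x => (mem_graph_ofLinear _ _ _).2 ?_, fun x => ?_⟩
    · exact congrArg (fun f : X →L[ℂ] X => f x) h1
    · exact congrArg (fun f : X →L[ℂ] X => f x) h2

theorem subLinear_ofLinear_smul_coe (a P : X →L[ℂ] X) (ξ : ℂ) :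
    subLinear (ofLinear (a : X →ₗ[ℂ] X)) (ξ • (P : X →ₗ[ℂ] X)) =
      ofLinear ((a - ξ • P : X →L[ℂ] X) : X →ₗ[ℂ] X) :=
  subLinear_ofLinear _ _

/-- The algebraic relations of the Drazin inverse related to a spectral set. -/
theorem IsRelDrazinInverse.relations {a P B : X →L[ℂ] X} {s : Set ℂ}
    (h : IsRelDrazinInverse (ofLinear (a : X →ₗ[ℂ] X)) s P B) :
    a * B = 1 - P ∧ Commute B a ∧ P * B = 0 ∧ B * (1 - P) = B := by
  obtain ⟨hP, ξ, C, -, hC, rfl⟩ := h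
  have hPa := hP.commute
  have hid := hP.1
  rw [subLinear_ofLinear_smul_coe, isBoundedInverse_ofLinear_coe_iff] at hC
  obtain ⟨h1, h2⟩ := hC
  let u : (X →L[ℂ] X)ˣ := ⟨a - ξ • P, C, h1, h2⟩
  have haC : Commute a C := by
    have : Commute a (u : X →L[ℂ] X) := (Commute.refl a).sub_right (hPa.symm.smul_right _)
    exact this.units_inv_right
  have hPC : Commute P C := by
    have : Commute P (u : X →L[ℂ] X) := hPa.sub_right ((Commute.refl P).smul_right _)
    exact this.units_inv_right
  have hP0 : P * (1 - P) = 0 := by rw [mul_sub, mul_one, hid.eq, sub_self]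
  change a * (C * (1 - P)) = 1 - P ∧ Commute (C * (1 - P)) a ∧ P * (C * (1 - P)) = 0 ∧
    C * (1 - P) * (1 - P) = C * (1 - P)
  refine ⟨?_, ?_, ?_, ?_⟩
  · have h3 : a * C = 1 + ξ • (C * P) := by
      rw [← h1, sub_mul, smul_mul_assoc, hPC.eq, sub_add_cancel]
    rw [← mul_assoc, h3, add_mul, one_mul, smul_mul_assoc, mul_assoc, hP0, mul_zero, smul_zero,
      add_zero]
  · exact (haC.mul_right ((Commute.one_right a).sub_right hPa.symm)).symm
  · rw [← mul_assoc, hPC.eq, mul_assoc, hP0, mul_zero]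
  · rw [mul_assoc, hid.one_sub.eq]

variable [CompleteSpace X]

/-- `a - ξP` is `a` on the null space of `P`, where `0` is regular because it belongs to `s`, and `a
- ξ` on the range, where `ξ` is regular because it lies outside `s`. -/
theorem IsSuitable.exists_isRelDrazinInverse {a : X →L[ℂ] X} {s : Set ℂ}
    (hs : IsSuitable (ofLinear (a : X →ₗ[ℂ] X)) s) :
    ∃ P B : X →L[ℂ] X, IsRelDrazinInverse (ofLinear (a : X →ₗ[ℂ] X)) s P B := by
  obtain ⟨P, hP⟩ := hs.exists_isSpectralProjection
  have hPa := hP.commute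
  have hid := hP.1
  obtain ⟨-, hred, hM, hN⟩ := id hP
  have hbdd : BddAbove (norm '' s) := by
    obtain ⟨R, hR⟩ := hs.isBoundedSpectralSet.1.exists_norm_le
    exact ⟨R, by rintro _ ⟨z, hz, rfl⟩; exact hR z hz⟩
  have hsup0 : 0 ≤ sSup (norm '' s) := Real.sSup_nonneg (by rintro _ ⟨z, -, rfl⟩; positivity)
  -- The `+ 1` makes the required inequality strict and keeps `ξ` out of `s` even when `s = {0}`.
  let ξ : ℂ := ((2 * sSup (norm '' s) + 1 : ℝ) : ℂ)
  have hξ : ‖ξ‖ = 2 * sSup (norm '' s) + 1 := by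
    rw [Complex.norm_real, Real.norm_of_nonneg (by positivity)]
  have hξs : ξ ∉ s := by
    intro h
    have := le_csSup hbdd ⟨ξ, h, rfl⟩
    rw [hξ] at this
    linarith
  have h0M : (0 : ℂ) ∈ resolventSet (part (ofLinear (a : X →ₗ[ℂ] X)) _ hred.map_left) := by
    by_contra h
    have h' : (0 : ℂ) ∈ spec (part (ofLinear (a : X →ₗ[ℂ] X)) _ hred.map_left) := h
    rw [hM] at h'
    exact h'.2 hs.zero_mem
  have hξN : ξ ∈ resolventSet (part (ofLinear (a : X →ₗ[ℂ] X)) _ hred.map_right) := by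
    by_contra h
    have h' : ξ ∈ spec (part (ofLinear (a : X →ₗ[ℂ] X)) _ hred.map_right) := h
    rw [hN] at h'
    exact hξs h'
  rw [mem_resolventSet_part_ofLinear] at h0M hξN
  obtain ⟨hMi, hMs⟩ := h0M
  obtain ⟨hNi, hNs⟩ := hξN
  have hPP : ∀ y, P (P y) = P y := fun y => congrArg (fun f : X →L[ℂ] X => f y) hid.eq
  have hPa' : ∀ x, P (a x) = a (P x) := fun x => congrArg (fun f : X →L[ℂ] X => f x) hPa.eq
  have hbij : Function.Bijective (a - ξ • P : X →L[ℂ] X) := by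
    have happ : ∀ x, (a - ξ • P : X →L[ℂ] X) x = a x - ξ • P x := fun _ => rfl
    constructor
    · rw [injective_iff_map_eq_zero]
      intro x hx
      rw [happ] at hx
      have h1 : ξ • P x - a (P x) = 0 := by
        have := congrArg P hx
        rw [map_sub, map_smul, hPP, hPa', map_zero] at this
        rw [← neg_eq_zero, neg_sub, this]
      have h2 : P x = 0 := hNi (P x) ⟨x, rfl⟩ h1
      rw [h2, smul_zero, sub_zero] at hx
      refine hMi x h2 ?_
      change (0 : ℂ) • x - a x = 0
      rw [hx, zero_smul, sub_zero]
    · intro y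
      obtain ⟨m, hm, hmy⟩ := hMs (y - P y) (by
        change P (y - P y) = 0
        rw [map_sub, hPP, sub_self])
      obtain ⟨n, hn, hny⟩ := hNs (P y) ⟨y, rfl⟩
      have hm0 : P m = 0 := hm
      have hn0 : P n = n := by
        obtain ⟨u, rfl⟩ := hn
        exact hPP u
      have hmy' : (0 : ℂ) • m - a m = y - P y := hmy
      have hny' : ξ • n - a n = P y := hny
      refine ⟨-m - n, ?_⟩
      rw [happ, map_sub, map_neg, map_sub, map_neg, hm0, hn0]
      calc -a m - a n - ξ • (-0 - n) = ((0 : ℂ) • m - a m) + (ξ • n - a n) := by module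
        _ = y := by rw [hmy', hny']; abel
  obtain ⟨u, hu⟩ := ContinuousLinearMap.isUnit_iff_bijective.2 hbij
  refine ⟨P, (↑u⁻¹ : X →L[ℂ] X) ∘L (1 - P), hP, ξ, ↑u⁻¹, ?_, ?_, rfl⟩
  · rw [hξ]
    linarith
  · rw [subLinear_ofLinear_smul_coe, isBoundedInverse_ofLinear_coe_iff, ← hu]
    exact ⟨u.mul_inv, u.inv_mul⟩

/-- The compression of `a` to the range of the spectral projection of a suitable set is a Riesz
operator. -/
theorem IsSuitable.isRiesz_mul (hX : ¬ FiniteDimensional ℂ X) {a P : X →L[ℂ] X} {s : Set ℂ}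
    (hs : IsSuitable (ofLinear (a : X →ₗ[ℂ] X)) s)
    (hP : IsSpectralProjection (ofLinear (a : X →ₗ[ℂ] X)) s P) : IsRiesz (a * P) := by
  have hPa := hP.commute
  have hid := hP.1
  have hPP : ∀ y, P (P y) = P y := fun y => congrArg (fun f : X →L[ℂ] X => f y) hid.eq
  have hPa' : ∀ x, P (a x) = a (P x) := fun x => congrArg (fun f : X →L[ℂ] X => f x) hPa.eq
  obtain ⟨-, hred, -, hN⟩ := id hP
  have hsub : essSpec (ofLinear ((a * P : X →L[ℂ] X) : X →ₗ[ℂ] X)) ⊆ {0} := by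
    intro z hz
    by_contra hz0
    have hz0 : z ≠ 0 := hz0
    apply hz
    rw [subLinear_ofLinear_smul, isFredholm_ofLinear_coe_iff]
    have happ : ∀ x, (a * P - z • 1 : X →L[ℂ] X) x = a (P x) - z • x := fun _ => rfl
    -- Eigenvectors of `aP` for the nonzero value `z` lie in the range of `P`.
    have hfix : ∀ x, (a * P - z • 1 : X →L[ℂ] X) x = 0 → P x = x := by
      intro x hx
      rw [happ, sub_eq_zero] at hx
      have h1 : z • P x = z • x := by rw [← map_smul, ← hx, hPa', hPP]
      exact smul_right_injective X hz0 h1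
    -- On the null space of `P` the operator `aP - z` is the invertible scalar `-z`, so only `a - z`
    -- on the range of `P` matters.
    have hcomp : ∀ n m, P n = n → P m = 0 →
        (a * P - z • 1 : X →L[ℂ] X) (n - z⁻¹ • m) = (a n - z • n) + m := by
      intro n m hn hm
      rw [happ, map_sub, map_smul, hn, hm, smul_zero, sub_zero, smul_sub, smul_smul,
        mul_inv_cancel₀ hz0, one_smul]
      abel
    by_cases hzs : z ∈ s
    · have hB : IsBrowder (ofLinear ((a - z • 1 : X →L[ℂ] X) : X →ₗ[ℂ] X)) := by
        rw [← subLinear_ofLinear_smul]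
        exact not_not.1 (hs.riesz ⟨hzs, hz0⟩).2
      obtain ⟨hk, hr⟩ := (isFredholm_ofLinear_coe_iff _).1 hB.isFredholm
      constructor
      · refine Submodule.finiteDimensional_of_le
          (S₂ := LinearMap.ker ((a - z • 1 : X →L[ℂ] X) : X →ₗ[ℂ] X)) fun x hx => ?_
        have hx' := hfix x hx
        have hx0 : a (P x) - z • x = 0 := hx
        rw [hx'] at hx0
        exact hx0
      · have hle : LinearMap.range ((a - z • 1 : X →L[ℂ] X) : X →ₗ[ℂ] X) ≤
            LinearMap.range ((a * P - z • 1 : X →L[ℂ] X) : X →ₗ[ℂ] X) := by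
          rintro _ ⟨x, rfl⟩
          -- `y` is the null-space component of `(a - z)x`. It is reached by `-z⁻¹y`, while `Px`
          -- takes care of the other component.
          let y := a (x - P x) - z • (x - P x)
          have hPy : P y = 0 := by
            simp only [y, map_sub, map_smul, hPa', hPP, sub_self, smul_zero]
          refine ⟨P x - z⁻¹ • y, ?_⟩
          change (a * P - z • 1 : X →L[ℂ] X) (P x - z⁻¹ • y) = a x - z • x
          rw [hcomp _ _ (hPP x) hPy]
          simp only [y, map_sub, smul_sub]
          abel
        exact FiniteDimensional.of_surjective (Submodule.factor hle)
          (Submodule.factor_surjective hle)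
    · have hres : z ∈ resolventSet (part (ofLinear (a : X →ₗ[ℂ] X)) _ hred.map_right) := by
        by_contra h
        have h' : z ∈ spec (part (ofLinear (a : X →ₗ[ℂ] X)) _ hred.map_right) := h
        rw [hN] at h'
        exact hzs h'
      rw [mem_resolventSet_part_ofLinear] at hres
      obtain ⟨hi, hsj⟩ := hres
      have hk : LinearMap.ker ((a * P - z • 1 : X →L[ℂ] X) : X →ₗ[ℂ] X) = ⊥ := by
        rw [LinearMap.ker_eq_bot']
        intro x hx
        have hx' := hfix x hx
        have hx0 : a (P x) - z • x = 0 := hx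
        refine hi x ⟨x, hx'⟩ ?_
        change z • x - a x = 0
        rw [hx', sub_eq_zero] at hx0
        rw [hx0, sub_self]
      have hr : LinearMap.range ((a * P - z • 1 : X →L[ℂ] X) : X →ₗ[ℂ] X) = ⊤ := by
        rw [LinearMap.range_eq_top]
        intro y
        obtain ⟨n, ⟨v, hv⟩, hny⟩ := hsj (P y) ⟨y, rfl⟩
        have hny' : z • n - a n = P y := hny
        have hPn : P n = n := by
          have hv' : P v = n := hv
          rw [← hv', hPP]
        refine ⟨-n - z⁻¹ • (y - P y), ?_⟩
        change (a * P - z • 1 : X →L[ℂ] X) _ = y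
        rw [hcomp _ _ (by rw [map_neg, hPn]) (by rw [map_sub, hPP, sub_self]), map_neg, smul_neg]
        calc -a n - -(z • n) + (y - P y) = (z • n - a n) + (y - P y) := by abel
          _ = y := by rw [hny']; abel
      rw [hk, hr]
      exact ⟨inferInstance, inferInstance⟩
  -- Infinite dimension enters here: it rules out an empty essential spectrum, so the inclusion in
  -- `{0}` is an equality.
  exact (Set.Nonempty.subset_singleton_iff (essSpec_ofLinear_coe_nonempty hX (a * P))).1 hsub

theorem IsSuitable.isGenDrazinRieszInverse (hX : ¬ FiniteDimensional ℂ X) {a P B : X →L[ℂ] X}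
    {s : Set ℂ} (hs : IsSuitable (ofLinear (a : X →ₗ[ℂ] X)) s)
    (h : IsRelDrazinInverse (ofLinear (a : X →ₗ[ℂ] X)) s P B) :
    IsGenDrazinRieszInverse (ofLinear (a : X →ₗ[ℂ] X)) B := by
  obtain ⟨haB, hBa, -, hBP⟩ := h.relations
  have haB' : ∀ x, a (B x) = x - P x := fun x => congrArg (fun f : X →L[ℂ] X => f x) haB
  refine ⟨fun _ => trivial, fun _ => trivial, fun x => ?_, fun x => ?_, a * P, fun x => ?_,
    hs.isRiesz_mul hX h.1⟩
  · change B (a (B x)) = B x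
    rw [haB']
    exact congrArg (fun f : X →L[ℂ] X => f x) hBP
  · exact congrArg (fun f : X →L[ℂ] X => f x) hBa.eq
  · change a (P x) = a (x - a (B x))
    rw [haB', sub_sub_cancel]

end DrazinInverse

end ClosedOp

theorem mainTheorem7 {X : Type*} [NormedAddCommGroup X] [NormedSpace ℂ X] [CompleteSpace X]
    (hX : ¬ FiniteDimensional ℂ X) (A : X →ₗ.[ℂ] X) (hA : ClosedOp.MemChat A)
    (h0 : (0 : ℂ) ∈ ClosedOp.isoPts (ClosedOp.browderSpec A)) :
    (∃ s : Set ℂ, ClosedOp.IsSuitable A s) ∧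
    ∀ s : Set ℂ, ClosedOp.IsSuitable A s →
      (∃ P B : X →L[ℂ] X, ClosedOp.IsRelDrazinInverse A s P B) ∧
      ∀ P B : X →L[ℂ] X, ClosedOp.IsRelDrazinInverse A s P B →
        ClosedOp.IsGenDrazinRieszInverse A B ∧
        ClosedOp.IsBoundedProd A P ∧ ClosedOp.IsBoundedProd A B ∧
        (∀ p : ℕ, ClosedOp.IsBoundedProd (ClosedOp.pow A p) (1 - ClosedOp.prodL A B)) ∧
        ∀ z : ℂ, spectralRadius ℂ (ClosedOp.prodL A P) < ‖z‖ₑ →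
          ‖z‖ₑ < (spectralRadius ℂ B)⁻¹ →
          z ∈ ClosedOp.resolventSet A ∧
          ∃ S T : X →L[ℂ] X,
            HasSum (fun p : ℕ => (z ^ (p + 1))⁻¹ •
              ClosedOp.prodL (ClosedOp.pow A p) (1 - ClosedOp.prodL A B)) S ∧
            HasSum (fun p : ℕ => z ^ p • B ^ (p + 1)) T ∧
            ClosedOp.IsBoundedInverse (ClosedOp.scalarSub z A) (S - T) := by
  obtain ⟨a, rfl⟩ := hA.exists_eq_ofLinear_coe
  refine ⟨ClosedOp.exists_isSuitable a h0, fun s hs => ⟨hs.exists_isRelDrazinInverse, ?_⟩⟩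
  intro P B h
  obtain ⟨haB, hBa, hPB, -⟩ := h.relations
  refine ⟨hs.isGenDrazinRieszInverse hX h, ClosedOp.isBoundedProd_ofLinear a P,
    ClosedOp.isBoundedProd_ofLinear a B, fun p => ?_, fun z hz hz' => ?_⟩
  · rw [ClosedOp.pow_ofLinear_coe]
    exact ClosedOp.isBoundedProd_ofLinear _ _
  · rw [ClosedOp.prodL_ofLinear] at hz
    obtain ⟨S, T, hS, hT, h1, h2⟩ :=
      ClosedOp.exists_laurent_hasSum h.1.1 h.1.commute haB hBa hPB hz hz'
    refine ⟨?_, S, T, ?_, hT, ?_⟩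
    · rw [ClosedOp.mem_resolventSet_ofLinear_coe, spectrum.mem_resolventSet_iff]
      exact ⟨⟨_, _, h1, h2⟩, rfl⟩
    -- Here `1 - aB = P`, so the coefficients are the `a^p P` of the abstract expansion.
    · simpa only [ClosedOp.pow_ofLinear_coe, ClosedOp.prodL_ofLinear, haB, sub_sub_cancel] using hS
    · rw [ClosedOp.scalarSub_ofLinear]
      exact (ClosedOp.isBoundedInverse_ofLinear_coe_iff (algebraMap ℂ (X →L[ℂ] X) z - a) _).2
        ⟨h1, h2⟩
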